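/- **Setting.** Let $\theta=\frac{1+\sqrt7\,i}{2}$ and let $\mathcal O\subset \mathrm{SL}_3(\mathbb C)$ be the group of the $24$ signed permutation matrices of determinant $1$ (the rotations of the cube with vertices $(\pm1,\pm1,\pm1)$). Put $$Q=\frac12\begin{pmatrix}1&1&-\theta\\1&1&\theta\\1-\theta&\theta-1&0\end{pmatrix},\qquad M=\begin{pmatrix}2&0&\kappa\\1&\sqrt3&-\kappa\\-1&\sqrt3&\kappa\end{pmatrix},\qquad \kappa=\frac{5-3\theta}{2}.$$ The group $\langle \mathcal O,Q\rangle$ acts on $\mathbb{CP}^2$ in coordinates $x$; in the coordinates $y$ given by $x=My$ it becomes $M^{-1}\langle \mathcal O,Q\rangle M$. Let $K_{168}\subset\mathrm{PGL}_3(\mathbb C)$ be the image of this last group; it is Klein's simple group of order $168$. A *reflection line* is a line of $\mathbb{CP}^2$ that is fixed pointwise by an involution in $K_{168}$. A *holomorphic map* $f:\mathbb{CP}^2\to\mathbb{CP}^2$ is a map $f=[P_1:P_2:P_3]$ given by three homogeneous polynomials of the same degree with no common zero in $\mathbb C^3\setminus\{0\}$. It is *$K_{168}$-equivariant* if $f(Tp)=Tf(p)$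 for all $T\in K_{168}$ and $p\in\mathbb{CP}^2$. It is *doubly critical exactly at the reflection lines* if the critical set $\{\det J(P)=0\}$, where $J(P)=(\partial P_i/\partial y_j)$, is the union of the reflection lines and every linear form that defines a reflection line divides $\det J(P)$ with multiplicity exactly $2$. Define $$F=3(y_1^4+y_2^4)-49y_3^4-14y_1^3y_3+6y_1^2y_2^2-21(y_1^2+y_2^2)y_3^2+42y_1y_2^2y_3,$$ $$\Phi=-\frac1{1512}\det H(F),\qquad \Psi=-\frac1{9072}\det\begin{pmatrix}H(F)&\nabla\Phi\\ (\nabla\Phi)^T&0\end{pmatrix},$$ where $H(F)$ is the Hessian matrix of $F$; these have degrees $4,6,14$. Let $g_9=(a_1,a_2,a_3)$ and $g_{11}=(b_1,b_2,b_3)$, where $$a_1=27y_1^9 + 336y_1^8y_3 - 4428y_1^7y_2^2 + 308y_1^7y_3^2 - 14700y_1^6y_3^3 - 10920y_1^6y_2^2y_3 - 13446y_1^5y_2^4 - 151851y_1^5y_3^4 + 18564y_1^5y_2^2y_3^2 - 149548y_1^4y_3^5 - 192864y_1^4y_2^2y_3^3 + 33600y_1^4y_2^4y_3 - 5436y_1^3y_2^6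 - 8232y_1^3y_3^6 - 44394y_1^3y_2^2y_3^4 - 116676y_1^3y_2^4y_3^2 + 605052y_1^2y_3^7 - 329280y_1^2y_2^2y_3^5 - 104076y_1^2y_2^4y_3^3 - 11592y_1^2y_2^6y_3 + 3555y_1y_2^8 - 261709y_1y_3^8 - 8232y_1y_2^2y_3^6 - 238287y_1y_2^4y_3^4 + 37548y_1y_2^6y_3^2 - 605052y_2^2y_3^7 + 259308y_2^4y_3^5 + 74088y_2^6y_3^3$$ $$a_2=-y_2(4509y_1^8 + 4956y_1^7y_3 - 1620y_1^6y_2^2 + 39382y_1^6y_3^2 - 207564y_1^5y_3^3 - 22596y_1^5y_2^2y_3 - 7722y_1^4y_2^4 + 22197y_1^4y_3^4 - 111174y_1^4y_2^2y_3^2 - 628376y_1^3y_3^5 - 177576y_1^3y_2^2y_3^3 + 24612y_1^3y_2^4y_3 - 612y_1^2y_2^6 + 8232y_1^2y_3^6 + 476574y_1^2y_2^2y_3^4 + 24066y_1^2y_2^4y_3^2 + 1210104y_1y_3^7 - 189336y_1y_2^2y_3^5 + 29988y_1y_2^4y_3^3 - 4284y_1y_2^6y_3 + 981y_2^8 + 261709y_3^8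 + 8232y_2^2y_3^6 + 108633y_2^4y_3^4 + 2142y_2^6y_3^2)$$ $$a_3=224y_1^9 + 2547y_1^8y_3 - 2016y_1^7y_2^2 + 9156y_1^7y_3^2 + 7952y_1^6y_3^3 + 19260y_1^6y_2^2y_3 + 6048y_1^5y_2^4 - 57918y_1^5y_3^4 - 9156y_1^5y_2^2y_3^2 + 150675y_1^4y_3^5 - 43176y_1^4y_2^2y_3^3 + 18306y_1^4y_2^4y_3 - 6048y_1^3y_2^6 - 48706y_1^3y_3^6 + 115836y_1^3y_2^2y_3^4 - 45780y_1^3y_2^4y_3^2 - 51450y_1^2y_3^7 + 301350y_1^2y_2^2y_3^5 + 68544y_1^2y_2^4y_3^3 + 5148y_1^2y_2^6y_3 + 146118y_1y_2^2y_3^6 + 173754y_1y_2^4y_3^4 - 27468y_1y_2^6y_3^2 + 7203y_3^9 - 51450y_2^2y_3^7 + 150675y_2^4y_3^5 + 504y_2^6y_3^3 + 3555y_2^8y_3$$ $$b_1=-1334y_1^{11} - 2534y_1^{10}y_3 - 63034y_1^9y_2^2 + 47355y_1^9y_3^2 + 542136y_1^8y_3^3 + 45864y_1^8y_2^2y_3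 - 88716y_1^7y_2^4 + 1184232y_1^7y_3^4 - 551460y_1^7y_2^2y_3^2 - 312816y_1^6y_3^5 + 2446080y_1^6y_2^2y_3^3 - 308196y_1^6y_2^4y_3 - 114084y_1^5y_2^6 - 4519368y_1^5y_3^6 - 6856668y_1^5y_2^2y_3^4 + 735714y_1^5y_2^4y_3^2 + 432180y_1^4y_3^7 + 625632y_1^4y_2^2y_3^5 - 446880y_1^4y_2^4y_3^3 + 634536y_1^4y_2^6y_3 + 18306y_1^3y_2^8 - 11503191y_1^3y_3^8 + 4272408y_1^3y_2^2y_3^6 + 4515840y_1^3y_2^4y_3^4 + 1066716y_1^3y_2^6y_3^2 + 5176556y_1^2y_3^9 + 18670176y_1^2y_2^2y_3^7 + 938448y_1^2y_2^4y_3^5 - 268128y_1^2y_2^6y_3^3 - 162918y_1^2y_2^8y_3 + 5022y_1y_2^{10} + 9311078y_1y_3^{10} - 11503191y_1y_2^2y_3^8 - 8956416y_1y_2^4y_3^6 + 2019780y_1y_2^6y_3^4 - 267813y_1y_2^8y_3^2 - 5176556y_2^2y_3^9 - 6655572y_2^4y_3^7 - 814968y_2^8y_3^3$$ $$b_2=y_2(-17294y_1^{10}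 - 60746y_1^9y_3 - 36546y_1^8y_2^2 + 309309y_1^8y_3^2 - 1631112y_1^7y_3^3 + 356328y_1^7y_2^2y_3 - 77628y_1^6y_2^4 - 1056930y_1^6y_3^4 - 900732y_1^6y_2^2y_3^2 - 312816y_1^5y_3^5 - 5794152y_1^5y_2^2y_3^3 - 579852y_1^5y_2^4y_3 + 52236y_1^4y_2^6 + 2136204y_1^4y_3^6 - 1627290y_1^4y_2^2y_3^4 - 486738y_1^4y_2^4y_3^2 - 19534536y_1^3y_3^7 + 625632y_1^3y_2^2y_3^5 - 2348472y_1^3y_2^4y_3^3 + 168840y_1^3y_2^6y_3 + 1674y_1^2y_2^8 - 11503191y_1^2y_3^8 - 17912832y_1^2y_2^2y_3^6 + 9745218y_1^2y_2^4y_3^4 + 717444y_1^2y_2^6y_3^2 - 10353112y_1y_3^9 + 5359032y_1y_2^2y_3^7 + 938448y_1y_2^4y_3^5 - 1083096y_1y_2^6y_3^3 + 11718y_1y_2^8y_3 - 8586y_2^{10} + 9311078y_3^{10} - 11503191y_2^2y_3^8 - 2300844y_2^4y_3^6 - 221382y_2^6y_3^4 - 5859y_2^8y_3^2)$$ $$b_3=-(2464y_1^{11}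 + 8670y_1^{10}y_3 - 19712y_1^9y_2^2 + 26250y_1^9y_3^2 - 196119y_1^8y_3^3 - 79878y_1^8y_2^2y_3 + 44352y_1^7y_2^4 - 89376y_1^7y_3^4 - 201096y_1^7y_2^2y_3^2 - 1953924y_1^6y_3^5 - 276444y_1^6y_2^2y_3^3 - 77604y_1^6y_2^4y_3 + 1422078y_1^5y_3^6 + 89376y_1^5y_2^2y_3^4 + 579852y_1^5y_2^4y_3^2 + 1825446y_1^4y_3^7 - 6454476y_1^4y_2^2y_3^5 - 1007370y_1^4y_2^4y_3^3 + 114084y_1^4y_2^6y_3 - 66528y_1^3y_2^8 - 5978490y_1^3y_3^8 - 2844156y_1^3y_2^2y_3^6 + 446880y_1^3y_2^4y_3^4 - 634536y_1^3y_2^6y_3^2 + 4477865y_1^2y_3^9 + 3650892y_1^2y_2^2y_3^7 - 5466636y_1^2y_2^4y_3^5 - 1066716y_1^2y_2^6y_3^3 + 98118y_1^2y_2^8y_3 + 17935470y_1y_2^2y_3^8 - 4266234y_1y_2^4y_3^6 + 268128y_1y_2^6y_3^4 - 11718y_1y_2^8y_3^2 + 100842y_3^{11} + 4477865y_2^2y_3^9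 + 1825446y_2^4y_3^7 - 2019780y_2^6y_3^5 - 139671y_2^8y_3^3 - 5022y_2^{10}y_3)$$ **Theorem.** There are exactly $21$ reflection lines. The formula $$h=\Bigl(\frac{827}{14}F^2\Phi+\frac{99}{49}\Psi\Bigr)\cdot\mathrm{id}+\frac{11}{98}\,\Phi\cdot g_9+\frac{9}{49}\,F\cdot g_{11}$$ defines a holomorphic map $h:\mathbb{CP}^2\to\mathbb{CP}^2$ of degree $15$. This map is $K_{168}$-equivariant and doubly critical exactly at the $21$ reflection lines, and it is the only holomorphic $K_{168}$-equivariant map of $\mathbb{CP}^2$ (of any degree) that is doubly critical exactly at the $21$ reflection lines. -/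

import Mathlib

open scoped LinearAlgebra.Projectivization MatrixGroups Matrix

namespace KleinHeptic

noncomputable section

/-- The complex projective plane. -/
abbrev CP2 : Type := ℙ ℂ (Fin 3 → ℂ)

/-- Polynomials in the three homogeneous coordinates. -/
abbrev Poly3 : Type := MvPolynomial (Fin 3) ℂ

/-! ### Klein's group -/

/-- `θ = (1 + √7 i) / 2`. -/
def theta : ℂ := (1 + (Real.sqrt 7 : ℂ) * Complex.I) / 2

theorem theta_sq : theta ^ 2 = theta - 2 := by
  have h7 : ((Real.sqrt 7 : ℝ) : ℂ) ^ 2 = 7 := by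
    rw [← Complex.ofReal_pow, Real.sq_sqrt (by norm_num)]; norm_num
  have hI := Complex.I_sq
  unfold theta
  linear_combination (Complex.I ^ 2 / 4) * h7 + (7 / 4) * hI

/-- The octahedral rotation matrices: the signed permutation matrices of determinant `1`, that is,
the rotations of the cube with vertices `(±1, ±1, ±1)`. -/
def octahedralMatrices : Set (Matrix (Fin 3) (Fin 3) ℂ) :=
  {A | A.det = 1 ∧ ∃ (σ : Equiv.Perm (Fin 3)) (ε : Fin 3 → ℤˣ),
    A = Matrix.of fun i j => if σ j = i then (((ε j : ℤˣ) : ℤ) : ℂ) else 0}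

/-- The matrix `Q` of the additional generator of order four. -/
def matrixQ : Matrix (Fin 3) (Fin 3) ℂ :=
  (1 / 2 : ℂ) • !![1, 1, -theta; 1, 1, theta; 1 - theta, theta - 1, 0]

theorem matrixQ_det : matrixQ.det = 1 := by
  have h := theta_sq
  simp only [matrixQ, Matrix.det_smul, Matrix.det_fin_three, Fintype.card_fin]
  simp
  linear_combination (-1 / 2 : ℂ) * h

/-- The linear group of order 168, in the octahedral coordinates `x`: it is generated by the
octahedral rotations and by `Q`. -/
def linearGroupX : Subgroup (GL (Fin 3) ℂ) :=
  Subgroup.closure {g | (g : Matrix (Fin 3) (Fin 3) ℂ) ∈ octahedralMatrices ∨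
    (g : Matrix (Fin 3) (Fin 3) ℂ) = matrixQ}

/-- The matrix `M` of the change of coordinates `x = M y`. -/
def matrixM : Matrix (Fin 3) (Fin 3) ℂ :=
  !![2, 0, (5 - 3 * theta) / 2;
     1, (Real.sqrt 3 : ℂ), -((5 - 3 * theta) / 2);
     -1, (Real.sqrt 3 : ℂ), (5 - 3 * theta) / 2]

theorem matrixM_det_ne_zero : matrixM.det ≠ 0 := by
  have h3 : (Real.sqrt 3 : ℂ) ≠ 0 := by
    exact_mod_cast (Real.sqrt_pos.mpr (by norm_num : (0 : ℝ) < 3)).ne'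
  have hk : 5 - 3 * theta ≠ 0 := by
    intro h
    have ht : theta = 5 / 3 := by linear_combination (-1 / 3 : ℂ) * h
    have := theta_sq
    rw [ht] at this
    norm_num at this
  have hd : matrixM.det = 3 * (Real.sqrt 3 : ℂ) * (5 - 3 * theta) := by
    simp [matrixM, Matrix.det_fin_three]
    ring
  rw [hd]
  exact mul_ne_zero (mul_ne_zero (by norm_num) h3) hk

/-- The change of coordinates as an invertible matrix. -/
def coordChange : GL (Fin 3) ℂ :=
  Matrix.GeneralLinearGroup.mkOfDetNeZero matrixM matrixM_det_ne_zero

/-- The linear group of order 168 in the coordinates `y`: the matrices `g` for which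
`M g M⁻¹` belongs to the group in the coordinates `x`. -/
def linearGroup : Subgroup (GL (Fin 3) ℂ) :=
  linearGroupX.comap (MulAut.conj coordChange).toMonoidHom

/-- The projective group `K₁₆₈`, acting on the projective plane in the coordinates `y`. -/
def K168 : Subgroup PGL(3, ℂ) := linearGroup.map Matrix.ProjGenLinGroup.mk

/-! ### Reflection lines -/

/-- The projective line with equation `a₁ y₁ + a₂ y₂ + a₃ y₃ = 0`. -/
def projLine (a : Fin 3 → ℂ) : Set CP2 := {p | a ⬝ᵥ p.rep = 0}

/-- The linear form `a` defines a reflection line: a line fixed pointwise by an involution that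
belongs to `K₁₆₈`. -/
def IsReflectionForm (a : Fin 3 → ℂ) : Prop :=
  a ≠ 0 ∧ ∃ T ∈ K168, T ≠ 1 ∧ T * T = 1 ∧ ∀ p ∈ projLine a, T • p = p

/-- The set of all reflection lines. -/
def reflectionLines : Set (Set CP2) := {L | ∃ a, IsReflectionForm a ∧ L = projLine a}

/-- The linear form with coefficient vector `a`, as a polynomial. -/
def linearForm (a : Fin 3 → ℂ) : Poly3 := ∑ i, MvPolynomial.C (a i) * MvPolynomial.X i

/-! ### Holomorphic maps of the projective plane -/

/-- `P` is a homogeneous polynomial lift of degree `d` of `f : CP2 → CP2`: the three components of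
`P` are homogeneous of degree `d`, have no common zero other than the origin, and
`f [v] = [P v]` for all `v ≠ 0`. -/
def IsLift (d : ℕ) (P : Fin 3 → Poly3) (f : CP2 → CP2) : Prop :=
  (∀ i, (P i).IsHomogeneous d) ∧
    ∀ (v : Fin 3 → ℂ) (hv : v ≠ 0), ∃ hP : (fun i => MvPolynomial.eval v (P i)) ≠ 0,
      f (Projectivization.mk ℂ v hv) =
        Projectivization.mk ℂ (fun i => MvPolynomial.eval v (P i)) hP

/-- Holomorphic self-maps of the projective plane: the maps given in homogeneous coordinates by
three homogeneous polynomials of the same degree without common zeros. -/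
def IsHolomorphicMap (f : CP2 → CP2) : Prop := ∃ d P, IsLift d P f

/-- `f` commutes with the action of `K₁₆₈`. -/
def IsEquivariant (f : CP2 → CP2) : Prop := ∀ T ∈ K168, ∀ p : CP2, f (T • p) = T • f p

/-- The determinant of the Jacobian matrix of `P`. -/
def jacobianDet (P : Fin 3 → Poly3) : Poly3 :=
  (Matrix.of fun i j => MvPolynomial.pderiv j (P i)).det

/-- `f` is doubly critical exactly at the reflection lines: the critical set, which is the zero set
of the Jacobian determinant of a homogeneous lift, is the union of the reflection lines, and each
of these lines has multiplicity two in it. -/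
def IsDoublyCriticalAtReflectionLines (f : CP2 → CP2) : Prop :=
  ∃ d P, IsLift d P f ∧
    {p : CP2 | MvPolynomial.eval p.rep (jacobianDet P) = 0} = ⋃₀ reflectionLines ∧
    ∀ a, IsReflectionForm a → emultiplicity (linearForm a) (jacobianDet P) = 2

/-! ### Basic invariants and equivariants, and the map `h` -/

/-- The polynomial with the given list of terms: `(c, k, l, m)` stands for the monomial
`c y₁ ^ k y₂ ^ l y₃ ^ m`. -/
def ofTerms (L : List (ℤ × ℕ × ℕ × ℕ)) : Poly3 :=
  (L.map fun t => MvPolynomial.C (t.1 : ℂ) * MvPolynomial.X 0 ^ t.2.1 *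
    MvPolynomial.X 1 ^ t.2.2.1 * MvPolynomial.X 2 ^ t.2.2.2).sum

/-- The invariant `F` of degree `4` (Klein's quartic form). -/
def polyF : Poly3 :=
  ofTerms [(3, 4, 0, 0), (3, 0, 4, 0), (-49, 0, 0, 4), (-14, 3, 0, 1), (6, 2, 2, 0),
    (-21, 2, 0, 2), (-21, 0, 2, 2), (42, 1, 2, 1)]

/-- The Hessian matrix of `F`. -/
def hessianF : Matrix (Fin 3) (Fin 3) Poly3 :=
  Matrix.of fun i j => MvPolynomial.pderiv i (MvPolynomial.pderiv j polyF)

/-- The invariant `Φ` of degree `6`, a multiple of the Hessian determinant of `F`. -/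
def polyPhi : Poly3 := MvPolynomial.C (-1 / 1512) * hessianF.det

/-- The Hessian matrix of `F` bordered by the gradient of `Φ`. -/
def borderedHessian : Matrix (Fin 3 ⊕ Unit) (Fin 3 ⊕ Unit) Poly3 :=
  Matrix.fromBlocks hessianF (Matrix.of fun i _ => MvPolynomial.pderiv i polyPhi)
    (Matrix.of fun _ j => MvPolynomial.pderiv j polyPhi) 0

/-- The invariant `Ψ` of degree `14`, a multiple of the bordered Hessian determinant. -/
def polyPsi : Poly3 := MvPolynomial.C (-1 / 9072) * borderedHessian.det

/-- The basic equivariant `g₉` of degree `9`. -/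
def mapG9 : Fin 3 → Poly3 :=
  ![
    ofTerms [
      (27, 9, 0, 0), (336, 8, 0, 1), (-4428, 7, 2, 0), (308, 7, 0, 2), (-14700, 6, 0, 3),
      (-10920, 6, 2, 1), (-13446, 5, 4, 0), (-151851, 5, 0, 4), (18564, 5, 2, 2),
      (-149548, 4, 0, 5), (-192864, 4, 2, 3), (33600, 4, 4, 1), (-5436, 3, 6, 0),
      (-8232, 3, 0, 6), (-44394, 3, 2, 4), (-116676, 3, 4, 2), (605052, 2, 0, 7),
      (-329280, 2, 2, 5), (-104076, 2, 4, 3), (-11592, 2, 6, 1), (3555, 1, 8, 0),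
      (-261709, 1, 0, 8), (-8232, 1, 2, 6), (-238287, 1, 4, 4), (37548, 1, 6, 2),
      (-605052, 0, 2, 7), (259308, 0, 4, 5), (74088, 0, 6, 3)],
    ofTerms [
      (-4509, 8, 1, 0), (-4956, 7, 1, 1), (1620, 6, 3, 0), (-39382, 6, 1, 2), (207564, 5, 1, 3),
      (22596, 5, 3, 1), (7722, 4, 5, 0), (-22197, 4, 1, 4), (111174, 4, 3, 2), (628376, 3, 1, 5),
      (177576, 3, 3, 3), (-24612, 3, 5, 1), (612, 2, 7, 0), (-8232, 2, 1, 6), (-476574, 2, 3, 4),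
      (-24066, 2, 5, 2), (-1210104, 1, 1, 7), (189336, 1, 3, 5), (-29988, 1, 5, 3),
      (4284, 1, 7, 1), (-981, 0, 9, 0), (-261709, 0, 1, 8), (-8232, 0, 3, 6), (-108633, 0, 5, 4),
      (-2142, 0, 7, 2)],
    ofTerms [
      (224, 9, 0, 0), (2547, 8, 0, 1), (-2016, 7, 2, 0), (9156, 7, 0, 2), (7952, 6, 0, 3),
      (19260, 6, 2, 1), (6048, 5, 4, 0), (-57918, 5, 0, 4), (-9156, 5, 2, 2), (150675, 4, 0, 5),
      (-43176, 4, 2, 3), (18306, 4, 4, 1), (-6048, 3, 6, 0), (-48706, 3, 0, 6), (115836, 3, 2, 4),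
      (-45780, 3, 4, 2), (-51450, 2, 0, 7), (301350, 2, 2, 5), (68544, 2, 4, 3), (5148, 2, 6, 1),
      (146118, 1, 2, 6), (173754, 1, 4, 4), (-27468, 1, 6, 2), (7203, 0, 0, 9), (-51450, 0, 2, 7),
      (150675, 0, 4, 5), (504, 0, 6, 3), (3555, 0, 8, 1)]]

/-- The basic equivariant `g₁₁` of degree `11`. -/
def mapG11 : Fin 3 → Poly3 :=
  ![
    ofTerms [
      (-1334, 11, 0, 0), (-2534, 10, 0, 1), (-63034, 9, 2, 0), (47355, 9, 0, 2),
      (542136, 8, 0, 3), (45864, 8, 2, 1), (-88716, 7, 4, 0), (1184232, 7, 0, 4),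
      (-551460, 7, 2, 2), (-312816, 6, 0, 5), (2446080, 6, 2, 3), (-308196, 6, 4, 1),
      (-114084, 5, 6, 0), (-4519368, 5, 0, 6), (-6856668, 5, 2, 4), (735714, 5, 4, 2),
      (432180, 4, 0, 7), (625632, 4, 2, 5), (-446880, 4, 4, 3), (634536, 4, 6, 1),
      (18306, 3, 8, 0), (-11503191, 3, 0, 8), (4272408, 3, 2, 6), (4515840, 3, 4, 4),
      (1066716, 3, 6, 2), (5176556, 2, 0, 9), (18670176, 2, 2, 7), (938448, 2, 4, 5),
      (-268128, 2, 6, 3), (-162918, 2, 8, 1), (5022, 1, 10, 0), (9311078, 1, 0, 10),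
      (-11503191, 1, 2, 8), (-8956416, 1, 4, 6), (2019780, 1, 6, 4), (-267813, 1, 8, 2),
      (-5176556, 0, 2, 9), (-6655572, 0, 4, 7), (-814968, 0, 8, 3)],
    ofTerms [
      (-17294, 10, 1, 0), (-60746, 9, 1, 1), (-36546, 8, 3, 0), (309309, 8, 1, 2),
      (-1631112, 7, 1, 3), (356328, 7, 3, 1), (-77628, 6, 5, 0), (-1056930, 6, 1, 4),
      (-900732, 6, 3, 2), (-312816, 5, 1, 5), (-5794152, 5, 3, 3), (-579852, 5, 5, 1),
      (52236, 4, 7, 0), (2136204, 4, 1, 6), (-1627290, 4, 3, 4), (-486738, 4, 5, 2),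
      (-19534536, 3, 1, 7), (625632, 3, 3, 5), (-2348472, 3, 5, 3), (168840, 3, 7, 1),
      (1674, 2, 9, 0), (-11503191, 2, 1, 8), (-17912832, 2, 3, 6), (9745218, 2, 5, 4),
      (717444, 2, 7, 2), (-10353112, 1, 1, 9), (5359032, 1, 3, 7), (938448, 1, 5, 5),
      (-1083096, 1, 7, 3), (11718, 1, 9, 1), (-8586, 0, 11, 0), (9311078, 0, 1, 10),
      (-11503191, 0, 3, 8), (-2300844, 0, 5, 6), (-221382, 0, 7, 4), (-5859, 0, 9, 2)],
    ofTerms [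
      (-2464, 11, 0, 0), (-8670, 10, 0, 1), (19712, 9, 2, 0), (-26250, 9, 0, 2),
      (196119, 8, 0, 3), (79878, 8, 2, 1), (-44352, 7, 4, 0), (89376, 7, 0, 4), (201096, 7, 2, 2),
      (1953924, 6, 0, 5), (276444, 6, 2, 3), (77604, 6, 4, 1), (-1422078, 5, 0, 6),
      (-89376, 5, 2, 4), (-579852, 5, 4, 2), (-1825446, 4, 0, 7), (6454476, 4, 2, 5),
      (1007370, 4, 4, 3), (-114084, 4, 6, 1), (66528, 3, 8, 0), (5978490, 3, 0, 8),
      (2844156, 3, 2, 6), (-446880, 3, 4, 4), (634536, 3, 6, 2), (-4477865, 2, 0, 9),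
      (-3650892, 2, 2, 7), (5466636, 2, 4, 5), (1066716, 2, 6, 3), (-98118, 2, 8, 1),
      (-17935470, 1, 2, 8), (4266234, 1, 4, 6), (-268128, 1, 6, 4), (11718, 1, 8, 2),
      (-100842, 0, 0, 11), (-4477865, 0, 2, 9), (-1825446, 0, 4, 7), (2019780, 0, 6, 5),
      (139671, 0, 8, 3), (5022, 0, 10, 1)]]

/-- The homogeneous lift of `h`:
`(827/14 F² Φ + 99/49 Ψ) · id + 11/98 Φ · g₉ + 9/49 F · g₁₁`. -/
def mapH : Fin 3 → Poly3 := fun i =>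
  (MvPolynomial.C (827 / 14) * polyF ^ 2 * polyPhi + MvPolynomial.C (99 / 49) * polyPsi) *
      MvPolynomial.X i
    + MvPolynomial.C (11 / 98) * polyPhi * mapG9 i
    + MvPolynomial.C (9 / 49) * polyF * mapG11 i

end

end KleinHeptic

/-!
Let `L` be the product of the linear forms of the reflection lines. A map `P` of degree `n` that is
doubly critical exactly at these lines has `det J(P) = c L ^ 2` with `c ≠ 0`, so `3 (n - 1) = 42`
and `n = 15`. The linear group is generated by `21` conjugate half-turns, one of which is a product
of two others; it has no nontrivial characters, and so a homogeneous lift of an equivariant map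
commutes with the group itself and not only up to scalars.

Let `R ≠ 0` be a tuple of forms of odd degree `n < 21` that commutes with the group. Its second
component vanishes on the reflection line `y₂ = 0`, which is thus mapped to itself. If the Jacobian
determinant of the map induced on this line vanished, then so would a Wronskian, by Euler's
identity, and `R` would be constant on the line up to scalars; but the stabilizer of the line fixes
none of its points, so `R` would vanish on this and hence on every reflection line, and `L ∣ R`.
Therefore `y₂ ^ m ∣ det J(R)` implies `y₂ ^ (m + 1) ∣ R₂`, and in particular `det J(R) ≠ 0`.

The second component of `h` is divisible by `y₂ ^ 3`, hence `det J(h) = c L ^ 2` with `c ≠ 0`. If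
`P` is another such map, then `det J(P + t h)` is a multiple of `L ^ 2` for all `t`. A suitable `t`
makes it vanish at a point off the lines, hence identically, and then `P + t h = 0`.
-/

namespace KleinHeptic

open MvPolynomial

/-! ### Linear substitutions and covariants -/

section Covariants

variable {R m n : Type*} [CommRing R]

theorem derivation_aeval [Fintype m] {A : Type*} [CommRing A] [Algebra R A] (D : Derivation R A A)
    (f : m → A) (p : MvPolynomial m R) :
    D (aeval f p) = ∑ i, aeval f (pderiv i p) * D (f i) := by
  classical
  induction p using MvPolynomial.induction_on with
  | C a => simp
  | add p q hp hq => simp only [map_add, hp, hq, add_mul, Finset.sum_add_distrib]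
  | mul_X p i hp =>
    simp only [map_mul, aeval_X, Derivation.leibniz, smul_eq_mul, hp, pderiv_X, map_add,
      add_mul, Finset.sum_add_distrib, Finset.mul_sum, Pi.single_apply]
    simp [mul_assoc, apply_ite]

/-- The values `(P₁(v), P₂(v), …)` of a tuple of polynomials. -/
noncomputable def evalMap (P : m → MvPolynomial n R) (v : n → R) : m → R := fun i => eval v (P i)

theorem evalMap_X (v : n → R) : evalMap X v = v := funext fun _ => eval_X _

theorem eval_mulVec_map_C {o : Type*} [Fintype m] (A : Matrix o m R) (P : m → MvPolynomial n R)
    (v : n → R) (i : o) :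
    eval v ((A.map (C (σ := n)) *ᵥ P) i) = (A *ᵥ evalMap P v) i := by
  simp [evalMap, Matrix.mulVec, dotProduct]

/-- The gradient of a polynomial. -/
noncomputable def gradient (p : MvPolynomial n R) : n → MvPolynomial n R := fun i => pderiv i p

/-- The Hessian matrix of a polynomial. -/
noncomputable def hessian (p : MvPolynomial n R) : Matrix n n (MvPolynomial n R) :=
  Matrix.of fun i j => pderiv i (pderiv j p)

/-- The Hessian matrix of `p` bordered by the gradient of `q`. -/
noncomputable def bordered (p q : MvPolynomial n R) :
    Matrix (n ⊕ Unit) (n ⊕ Unit) (MvPolynomial n R) :=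
  Matrix.fromBlocks (hessian p) (Matrix.of fun i _ => gradient q i)
    (Matrix.of fun _ j => gradient q j) 0

/-- The Jacobian matrix of a tuple of polynomials. -/
noncomputable def jacobian (P : m → MvPolynomial n R) : Matrix m n (MvPolynomial n R) :=
  Matrix.of fun i j => pderiv j (P i)

theorem jacobian_mulVec [Fintype m] {o : Type*} (A : Matrix o m R) (P : m → MvPolynomial n R) :
    jacobian ((A.map (C (σ := n))) *ᵥ P) = A.map (C (σ := n)) * jacobian P := by
  ext1 i j
  simp [jacobian, Matrix.mulVec, dotProduct, Matrix.mul_apply]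

/-- The substitution `p ↦ p ∘ A`: the variables are replaced by the linear forms given by the rows
of `A`. -/
noncomputable def linearSubst [Fintype n] (A : Matrix m n R) :
    MvPolynomial m R →ₐ[R] MvPolynomial n R :=
  bind₁ A.toMvPolynomial

theorem eval_linearSubst [Fintype n] (A : Matrix m n R) (v : n → R) (p : MvPolynomial m R) :
    eval v (linearSubst A p) = eval (A *ᵥ v) p :=
  (eval₂Hom_bind₁ _ _ _ _).trans <|
    congrArg (eval · p) <| funext fun i => A.toMvPolynomial_eval_eq_apply i v

theorem linearSubst_linearSubst [Fintype m] [Fintype n] {o : Type*} (A : Matrix o m R)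
    (B : Matrix m n R) (p : MvPolynomial o R) :
    linearSubst B (linearSubst A p) = linearSubst (A * B) p := by
  simp only [linearSubst, bind₁_bind₁, ← Matrix.toMvPolynomial_mul]

theorem linearSubst_one [Fintype n] [DecidableEq n] (p : MvPolynomial n R) :
    linearSubst (1 : Matrix n n R) p = p := by
  rw [linearSubst, Matrix.toMvPolynomial_one, bind₁_X_left, AlgHom.id_apply]

variable [Fintype n]

theorem det_map_linearSubst {o : Type*} [Fintype o] [DecidableEq o]
    (A : Matrix m n R) (H : Matrix o o (MvPolynomial m R)) :
    (H.map (linearSubst A)).det = linearSubst A H.det :=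
  ((linearSubst A).map_det H).symm

theorem pderiv_toMvPolynomial (A : Matrix m n R) (i : m) (j : n) :
    pderiv j (A.toMvPolynomial i) = C (A i j) := by
  classical
  simp [Matrix.toMvPolynomial, pderiv_monomial, Finsupp.single_apply, apply_ite]

variable [Fintype m]

theorem pderiv_linearSubst (A : Matrix m n R) (j : n) (p : MvPolynomial m R) :
    pderiv j (linearSubst A p) = ∑ i, linearSubst A (pderiv i p) * C (A i j) :=
  (derivation_aeval (pderiv j) A.toMvPolynomial p).trans <| by
    simp only [pderiv_toMvPolynomial, linearSubst, aeval_eq_bind₁]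

theorem gradient_linearSubst (A : Matrix m n R) (p : MvPolynomial m R) :
    gradient (linearSubst A p) = (A.map (C (σ := n)))ᵀ *ᵥ (linearSubst A ∘ gradient p) := by
  funext j
  simp [gradient, pderiv_linearSubst, Matrix.mulVec, dotProduct, mul_comm]

theorem hessian_linearSubst (A : Matrix m n R) (p : MvPolynomial m R) :
    hessian (linearSubst A p) =
      (A.map (C (σ := n)))ᵀ * (hessian p).map (linearSubst A) * A.map (C (σ := n)) := by
  ext1 i j
  simp [hessian, pderiv_linearSubst, Matrix.mul_apply, mul_comm]

theorem bordered_linearSubst (A : Matrix m n R) (p q : MvPolynomial m R) :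
    bordered (linearSubst A p) (linearSubst A q) =
      (Matrix.fromBlocks (A.map (C (σ := n))) 0 0 (1 : Matrix Unit Unit _))ᵀ *
        (bordered p q).map (linearSubst A) *
          Matrix.fromBlocks (A.map (C (σ := n))) 0 0 (1 : Matrix Unit Unit _) := by
  rw [bordered, hessian_linearSubst, gradient_linearSubst, bordered, Matrix.fromBlocks_transpose,
    Matrix.fromBlocks_map, Matrix.fromBlocks_multiply, Matrix.fromBlocks_multiply]
  congr 1 <;> ext1 i j <;> simp [Matrix.mul_apply, Matrix.mulVec, dotProduct, mul_comm]

theorem jacobian_linearSubst {o : Type*} (A : Matrix m n R) (P : o → MvPolynomial m R) :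
    jacobian (fun i => linearSubst A (P i)) =
      (jacobian P).map (linearSubst A) * A.map (C (σ := n)) := by
  ext1 i j
  simp [jacobian, pderiv_linearSubst, Matrix.mul_apply]

variable [DecidableEq n] (A : Matrix n n R)

theorem det_map_C : (A.map (C (σ := n))).det = C A.det :=
  ((C : R →+* MvPolynomial n R).map_det A).symm

theorem det_hessian_linearSubst (p : MvPolynomial n R) :
    (hessian (linearSubst A p)).det = C (A.det ^ 2) * linearSubst A (hessian p).det := by
  rw [hessian_linearSubst, Matrix.det_mul, Matrix.det_mul, Matrix.det_transpose, det_map_C,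
    det_map_linearSubst, C_pow]
  ring

theorem det_bordered_linearSubst (p q : MvPolynomial n R) :
    (bordered (linearSubst A p) (linearSubst A q)).det =
      C (A.det ^ 2) * linearSubst A (bordered p q).det := by
  rw [bordered_linearSubst, Matrix.det_mul, Matrix.det_mul, Matrix.det_transpose,
    Matrix.det_fromBlocks_zero₂₁, Matrix.det_one, det_map_C, det_map_linearSubst, C_pow]
  ring

/-- The covariant `adj (H p) ∇ q` of two forms, which for invariants `p` and `q` of a group of
unimodular matrices is an equivariant map. -/
noncomputable def adjHessianGradient (p q : MvPolynomial n R) : n → MvPolynomial n R :=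
  (hessian p).adjugate *ᵥ gradient q

theorem mulVec_adjHessianGradient_linearSubst (p q : MvPolynomial n R) :
    A.map (C (σ := n)) *ᵥ adjHessianGradient (linearSubst A p) (linearSubst A q) =
      C (σ := n) (A.det ^ 2) • (linearSubst A ∘ adjHessianGradient p q) := by
  set B : Matrix n n (MvPolynomial n R) := A.map (C (σ := n)) with hB
  set H := (hessian p).map (linearSubst A)
  have hadj : B * (Bᵀ * H * B).adjugate * Bᵀ = C (σ := n) (A.det ^ 2) • H.adjugate := by
    calc B * (Bᵀ * H * B).adjugate * Bᵀ
        = (B * B.adjugate) * H.adjugate * (Bᵀ.adjugate * Bᵀ) := by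
          simp only [Matrix.adjugate_mul_distrib, Matrix.mul_assoc]
      _ = C (σ := n) (A.det ^ 2) • H.adjugate := by
          rw [Matrix.mul_adjugate, Matrix.adjugate_mul, Matrix.det_transpose, hB, det_map_C]
          simp [smul_smul, sq]
  have hmap : H.adjugate = (hessian p).adjugate.map (linearSubst A) :=
    ((linearSubst A).map_adjugate (hessian p)).symm
  rw [adjHessianGradient, hessian_linearSubst, gradient_linearSubst, Matrix.mulVec_mulVec,
    Matrix.mulVec_mulVec, hadj, hmap, Matrix.smul_mulVec]
  congr 1
  funext i
  simp [adjHessianGradient, Matrix.mulVec, dotProduct]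

end Covariants

/-! ### Equivariant tuples of polynomials -/

section Commutant

variable {R n : Type*} [CommRing R] [Fintype n] [DecidableEq n]

/-- The invertible matrices that commute with the polynomial map `v ↦ P(v)`. -/
noncomputable def commutant (P : n → MvPolynomial n R) : Subgroup (GL n R) where
  carrier := {g | ∀ v, evalMap P (g.1 *ᵥ v) = g.1 *ᵥ evalMap P v}
  one_mem' := by simp
  mul_mem' := by
    intro a b ha hb v
    rw [Units.val_mul, ← Matrix.mulVec_mulVec, ha, hb, Matrix.mulVec_mulVec]
  inv_mem' := by
    intro a ha v
    have h := ha (a⁻¹.1 *ᵥ v)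
    rw [Matrix.mulVec_mulVec, Units.mul_inv, Matrix.one_mulVec] at h
    rw [h, Matrix.mulVec_mulVec, Units.inv_mul, Matrix.one_mulVec]

variable {P Q : n → MvPolynomial n R} {g : GL n R}

theorem mem_commutant :
    g ∈ commutant P ↔ ∀ v, evalMap P (g.1 *ᵥ v) = g.1 *ᵥ evalMap P v := Iff.rfl

theorem commutant_inf_le_add : commutant P ⊓ commutant Q ≤ commutant (P + Q) := by
  rintro g ⟨hP, hQ⟩ v
  have h (w : n → R) : evalMap (P + Q) w = evalMap P w + evalMap Q w :=
    funext fun i => map_add (eval w) (P i) (Q i)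
  rw [h, h, mem_commutant.mp hP, mem_commutant.mp hQ, Matrix.mulVec_add]

theorem mul_mem_commutant {p : MvPolynomial n R} (hp : linearSubst g.1 p = p)
    (hP : g ∈ commutant P) : g ∈ commutant fun i => p * P i := by
  intro v
  have h (w : n → R) : evalMap (fun i => p * P i) w = eval w p • evalMap P w :=
    funext fun i => map_mul (eval w) p (P i)
  rw [h, h, ← eval_linearSubst, hp, mem_commutant.mp hP, Matrix.mulVec_smul]

theorem X_mem_commutant : g ∈ commutant (X : n → MvPolynomial n R) :=
  mem_commutant.mpr fun v => by rw [evalMap_X, evalMap_X]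

theorem mem_commutant_of_linearSubst
    (h : ∀ i, linearSubst g.1 (P i) = (g.1.map (C (σ := n)) *ᵥ P) i) : g ∈ commutant P := fun v =>
  funext fun i => by
    rw [← eval_mulVec_map_C, ← h, eval_linearSubst, evalMap]

theorem linearSubst_of_mem_commutant [IsDomain R] [Infinite R] (h : g ∈ commutant P) (i : n) :
    linearSubst g.1 (P i) = (g.1.map (C (σ := n)) *ᵥ P) i :=
  MvPolynomial.funext fun v => by
    rw [eval_mulVec_map_C, eval_linearSubst, ← mem_commutant.mp h, evalMap]

theorem linearSubst_det_jacobian [IsDomain R] [Infinite R] (hP : g ∈ commutant P) :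
    linearSubst g.1 (jacobian P).det = (jacobian P).det := by
  have hunit : IsUnit (C g.1.det : MvPolynomial n R) := (Matrix.isUnits_det_units g).map C
  refine hunit.mul_left_cancel ?_
  calc C g.1.det * linearSubst g.1 (jacobian P).det
      = (jacobian fun i => linearSubst g.1 (P i)).det := by
        rw [jacobian_linearSubst, Matrix.det_mul, det_map_C, det_map_linearSubst, mul_comm]
    _ = (jacobian (g.1.map (C (σ := n)) *ᵥ P)).det := by
        rw [show (fun i => linearSubst g.1 (P i)) = g.1.map (C (σ := n)) *ᵥ P from
          funext (linearSubst_of_mem_commutant hP)]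
    _ = C g.1.det * (jacobian P).det := by rw [jacobian_mulVec, Matrix.det_mul, det_map_C]

theorem adjHessianGradient_mem_commutant {p q : MvPolynomial n R} (hg : g.1.det = 1)
    (hp : linearSubst g.1 p = p) (hq : linearSubst g.1 q = q) :
    g ∈ commutant (adjHessianGradient p q) := by
  have h := mulVec_adjHessianGradient_linearSubst g.1 p q
  rw [hp, hq, hg, one_pow, C_1, one_smul] at h
  exact mem_commutant_of_linearSubst fun i => (congrFun h i).symm

end Commutant

theorem jacobianDet_eq (P : Fin 3 → Poly3) : jacobianDet P = (jacobian P).det := rfl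

theorem eval_linearForm (a v : Fin 3 → ℂ) : eval v (linearForm a) = a ⬝ᵥ v := by
  simp [linearForm, dotProduct]

theorem isHomogeneous_linearForm (a : Fin 3 → ℂ) : (linearForm a).IsHomogeneous 1 :=
  IsHomogeneous.sum _ _ _ fun i _ => isHomogeneous_C_mul_X (a i) i

theorem linearSubst_linearForm (A : Matrix (Fin 3) (Fin 3) ℂ) (a : Fin 3 → ℂ) :
    linearSubst A (linearForm a) = linearForm (a ᵥ* A) :=
  MvPolynomial.funext fun v => by
    rw [eval_linearSubst, eval_linearForm, eval_linearForm, Matrix.dotProduct_mulVec]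

/-! ### Half-turns -/

section HalfTurn

variable {R n : Type*} [CommRing R] [Fintype n] [DecidableEq n] {c f : n → R}

theorem vecMulVec_sub_one_mul_self (h : f ⬝ᵥ c = 2) :
    (Matrix.vecMulVec c f - 1) * (Matrix.vecMulVec c f - 1) = 1 := by
  rw [sub_mul, mul_sub, mul_one, one_mul, Matrix.vecMulVec_mul_vecMulVec, h, Matrix.vecMulVec_smul]
  module

/-- The half-turn that fixes the vector `c` and is `-1` on the kernel of the linear form `f`: the
negative of a reflection. In the projective plane both act alike, but only the half-turn has
determinant `1`. -/
def halfTurn (h : f ⬝ᵥ c = 2) : GL n R where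
  val := Matrix.vecMulVec c f - 1
  inv := Matrix.vecMulVec c f - 1
  val_inv := vecMulVec_sub_one_mul_self h
  inv_val := vecMulVec_sub_one_mul_self h

theorem halfTurn_mul_self (h : f ⬝ᵥ c = 2) : halfTurn h * halfTurn h = 1 :=
  Units.ext (vecMulVec_sub_one_mul_self h)

theorem halfTurn_mulVec (h : f ⬝ᵥ c = 2) (v : n → R) :
    (halfTurn h).1 *ᵥ v = (f ⬝ᵥ v) • c - v := by
  rw [halfTurn, Matrix.sub_mulVec, Matrix.one_mulVec, Matrix.vecMulVec_mulVec, op_smul_eq_smul]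

theorem mul_halfTurn {c' f' : n → R} (h : f ⬝ᵥ c = 2) (h' : f' ⬝ᵥ c' = 2) {g : GL n R} {s : R}
    (hc : g.1 *ᵥ c = s • c') (hf : f' ᵥ* g.1 = s • f) :
    g * halfTurn h = halfTurn h' * g := by
  ext1
  change g.1 * (Matrix.vecMulVec c f - 1) = (Matrix.vecMulVec c' f' - 1) * g.1
  rw [mul_sub, sub_mul, mul_one, one_mul, Matrix.mul_vecMulVec, Matrix.vecMulVec_mul, hc, hf,
    Matrix.smul_vecMulVec, Matrix.vecMulVec_smul]

end HalfTurn

section Projective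

variable {K n : Type*} [Field K] [Fintype n]

theorem exists_eq_smul_of_forall_dotProduct_eq_zero {a b : n → K}
    (h : ∀ v, a ⬝ᵥ v = 0 → b ⬝ᵥ v = 0) : ∃ s : K, b = s • a := by
  classical
  have hprop (i j : n) : b i * a j = b j * a i := by
    have hv := h (Pi.single i (a j) - Pi.single j (a i)) <| by
      rw [dotProduct_sub, dotProduct_single, dotProduct_single, mul_comm, sub_self]
    rwa [dotProduct_sub, dotProduct_single, dotProduct_single, sub_eq_zero] at hv
  rcases eq_or_ne a 0 with rfl | ha
  · exact ⟨0, funext fun i => by simpa using h (Pi.single i 1) (zero_dotProduct _)⟩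
  · obtain ⟨j, hj⟩ := Function.ne_iff.mp ha
    exact ⟨b j / a j, funext fun i => by
      rw [Pi.smul_apply, smul_eq_mul, div_mul_eq_mul_div, eq_div_iff hj, hprop]⟩

theorem exists_ne_zero_mulVec_eq_zero {m : Type*} [Fintype m]
    (hmn : Fintype.card m < Fintype.card n) (A : Matrix m n K) : ∃ v ≠ 0, A *ᵥ v = 0 := by
  have hker := LinearMap.ker_ne_bot_of_finrank_lt (f := A.mulVecLin) (by simpa using hmn)
  obtain ⟨v, hv, hv0⟩ := Submodule.exists_mem_ne_zero_of_ne_bot hker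
  exact ⟨v, hv0, hv⟩

variable [DecidableEq n]

theorem coe_eq_smul_one_of_mk_eq_one {g : GL n K} (hg : Matrix.ProjGenLinGroup.mk g = 1) :
    ∃ u : K, g.1 = u • 1 := by
  rw [Matrix.ProjGenLinGroup.mk_eq_one, Matrix.GeneralLinearGroup.center_eq_range_scalar] at hg
  obtain ⟨u, rfl⟩ := hg
  exact ⟨u, by simp [← Matrix.smul_one_eq_diagonal]⟩

theorem mk_smul_mk_eq_self_iff {g : GL n K} {v : n → K} (hv : v ≠ 0) :
    Matrix.ProjGenLinGroup.mk g • Projectivization.mk K v hv = Projectivization.mk K v hv ↔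
      ∃ u : K, u • v = g.1 *ᵥ v := by
  rw [Projectivization.PGL.mk_smul_mk, Projectivization.mk_eq_mk_iff']
  rfl

variable {c f : n → K}

theorem mk_halfTurn_smul_mk (h : f ⬝ᵥ c = 2) {v : n → K} (hv : v ≠ 0) (hfv : f ⬝ᵥ v = 0) :
    Matrix.ProjGenLinGroup.mk (halfTurn h) • Projectivization.mk K v hv =
      Projectivization.mk K v hv :=
  (mk_smul_mk_eq_self_iff hv).mpr ⟨-1, by rw [halfTurn_mulVec, hfv, zero_smul, zero_sub, neg_smul,
    one_smul]⟩

theorem exists_eq_smul_of_mk_halfTurn_smul (h : f ⬝ᵥ c = 2) {w : n → K} (hw : w ≠ 0)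
    (hfw : f ⬝ᵥ w ≠ 0) (hfix : Matrix.ProjGenLinGroup.mk (halfTurn h) •
      Projectivization.mk K w hw = Projectivization.mk K w hw) : c = (2 / (f ⬝ᵥ w)) • w := by
  obtain ⟨u, hu⟩ := (mk_smul_mk_eq_self_iff hw).mp hfix
  have hcw : (f ⬝ᵥ w) • c = (u + 1) • w := by
    rw [add_smul, one_smul, ← sub_eq_iff_eq_add, ← halfTurn_mulVec h, hu]
  have hu2 : 2 = u + 1 := by
    have hf := congrArg (f ⬝ᵥ ·) hcw
    simp only [dotProduct_smul, smul_eq_mul, h] at hf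
    rw [mul_comm] at hf
    exact mul_right_cancel₀ hfw hf
  rw [div_eq_inv_mul, mul_smul, hu2, ← hcw, inv_smul_smul₀ hfw]

variable [NeZero (2 : K)]

theorem mk_halfTurn_ne_one (h : f ⬝ᵥ c = 2) (hn : 1 < Fintype.card n) :
    Matrix.ProjGenLinGroup.mk (halfTurn h) ≠ 1 := by
  intro hone
  obtain ⟨u, hu⟩ := coe_eq_smul_one_of_mk_eq_one hone
  have hscalar (v : n → K) : (f ⬝ᵥ v) • c = (u + 1) • v := by
    rw [add_smul, one_smul, ← sub_eq_iff_eq_add, ← halfTurn_mulVec h, hu, Matrix.smul_mulVec,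
      Matrix.one_mulVec]
  obtain ⟨v, hv, hfv⟩ := exists_ne_zero_mulVec_eq_zero (by simpa) (Matrix.of fun _ : Unit => f)
  have hu1 : u + 1 = 0 := by
    have hfv0 : f ⬝ᵥ v = 0 := congrFun hfv ()
    have hzero := hscalar v
    rw [hfv0, zero_smul, eq_comm, smul_eq_zero] at hzero
    exact hzero.resolve_right hv
  have hc := congrArg (f ⬝ᵥ ·) (hscalar c)
  simp only [h, hu1, zero_smul, dotProduct_zero, dotProduct_smul, smul_eq_mul] at hc
  exact mul_ne_zero two_ne_zero two_ne_zero hc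

theorem exists_eq_smul_of_forall_mk_halfTurn_smul (h : f ⬝ᵥ c = 2) (hn : 2 < Fintype.card n)
    {a : n → K} (hfix : ∀ v (hv : v ≠ 0), a ⬝ᵥ v = 0 → Matrix.ProjGenLinGroup.mk (halfTurn h) •
      Projectivization.mk K v hv = Projectivization.mk K v hv) : ∃ s : K, f = s • a := by
  refine exists_eq_smul_of_forall_dotProduct_eq_zero fun w haw => ?_
  by_contra hfw
  obtain ⟨z, hz, hz0⟩ := exists_ne_zero_mulVec_eq_zero (by simpa) (Matrix.of ![a, f])
  have haz : a ⬝ᵥ z = 0 := congrFun hz0 0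
  have hfz : f ⬝ᵥ z = 0 := congrFun hz0 1
  have hc (x : n → K) (hax : a ⬝ᵥ x = 0) (hfx : f ⬝ᵥ x ≠ 0) : c = (2 / (f ⬝ᵥ x)) • x := by
    have hx : x ≠ 0 := by
      rintro rfl
      exact hfx (dotProduct_zero f)
    exact exists_eq_smul_of_mk_halfTurn_smul h hx hfx (hfix x hx hax)
  have hfwz : f ⬝ᵥ (w + z) = f ⬝ᵥ w := by rw [dotProduct_add, hfz, add_zero]
  have heq := (hc w haw hfw).symm.trans
    (hc (w + z) (by rw [dotProduct_add, haw, haz, add_zero]) (hfwz ▸ hfw))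
  rw [hfwz, smul_add, left_eq_add] at heq
  exact smul_ne_zero (div_ne_zero two_ne_zero hfw) hz heq

end Projective

/-! ### Exact arithmetic in `ℤ[θ]` -/

/-- The ring `ℤ[θ]`, with `θ ^ 2 = θ - 2`; all entries of the matrices of the linear group are
halves of its elements. -/
abbrev ZTheta : Type := QuadraticAlgebra ℤ (-2) 1

/-- The embedding of `ℤ[θ]` into the complex numbers. -/
noncomputable def toComplex : ZTheta →+* ℂ :=
  (QuadraticAlgebra.lift ⟨theta, by
    have h := theta_sq
    simp only [zsmul_eq_mul]
    push_cast
    linear_combination h⟩ : ZTheta →ₐ[ℤ] ℂ).toRingHom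

theorem toComplex_apply (z : ZTheta) : toComplex z = (z.re : ℂ) + z.im * theta := by
  simp [toComplex, QuadraticAlgebra.lift]

theorem theta_im_ne_zero : theta.im ≠ 0 := by
  have : (0 : ℝ) < Real.sqrt 7 := Real.sqrt_pos.mpr (by norm_num)
  simp [theta]

theorem toComplex_injective : Function.Injective toComplex := by
  rw [injective_iff_map_eq_zero]
  intro z hz
  rw [toComplex_apply] at hz
  have him : z.im = 0 := by simpa [theta_im_ne_zero] using congrArg Complex.im hz
  have hre : z.re = 0 := by simpa [him] using congrArg Complex.re hz
  exact QuadraticAlgebra.ext hre him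

/-- The complex matrix `A / 2` of a matrix `A` over `ℤ[θ]`. -/
noncomputable def half (A : Matrix (Fin 3) (Fin 3) ZTheta) : Matrix (Fin 3) (Fin 3) ℂ :=
  (1 / 2 : ℂ) • A.map toComplex

section Half

variable {A B C : Matrix (Fin 3) (Fin 3) ZTheta}

theorem half_smul (z : ZTheta) : half (z • A) = toComplex z • half A := by
  rw [half, half, Matrix.map_smulₛₗ _ toComplex _ fun x => map_mul toComplex z x, smul_comm]

theorem half_mul_half : half A * half B = (1 / 2 : ℂ) • half (A * B) := by
  rw [half, half, half, smul_mul_smul_comm, Matrix.map_mul, smul_smul]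

theorem half_two : half 2 = 1 := by
  ext i j
  rcases eq_or_ne i j with rfl | hij
  · simp [half, Matrix.ofNat_apply, map_ofNat]
  · simp [half, Matrix.ofNat_apply, hij]

theorem half_mul (h : A * B = (2 : ZTheta) • C) : half A * half B = half C := by
  rw [half_mul_half, h, half_smul, map_ofNat, smul_smul]
  norm_num

theorem half_mul_mul : half A * half B * half C = (1 / 4 : ℂ) • half (A * B * C) := by
  rw [half_mul_half, smul_mul_assoc, half_mul_half, smul_smul]
  norm_num

theorem eq_smul_one_of_half_eq_smul_one {c : ℂ} (h : half A = c • 1) : A = A 0 0 • 1 := by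
  have hA (i j : Fin 3) : toComplex (A i j) = 2 * (c • (1 : Matrix (Fin 3) (Fin 3) ℂ)) i j := by
    rw [← h]
    simp [half]
  ext1 i j
  refine toComplex_injective ?_
  rcases eq_or_ne i j with rfl | hij
  · simp [hA]
  · simp [hA, hij]

theorem det_half : (half A).det = (1 / 8 : ℂ) * toComplex A.det := by
  rw [half, Matrix.det_smul, RingHom.map_det, RingHom.mapMatrix_apply, Fintype.card_fin]
  norm_num

end Half

/-! ### The octahedral rotations -/

/-- The permutation parts of the octahedral rotations. -/
def octPerm : Fin 6 → Fin 3 → Fin 3 :=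
  ![![0, 1, 2], ![0, 2, 1], ![1, 0, 2], ![1, 2, 0], ![2, 0, 1], ![2, 1, 0]]

/-- The signs of the permutations `octPerm`. -/
def octPermSign : Fin 6 → ℤ := ![1, -1, -1, 1, 1, -1]

/-- The even sign changes. -/
def octSign : Fin 4 → Fin 3 → ℤ := ![![1, 1, 1], ![1, -1, -1], ![-1, 1, -1], ![-1, -1, 1]]

/-- The doubles of the octahedral rotations. -/
def twiceOct (i : Fin 24) : Matrix (Fin 3) (Fin 3) ZTheta :=
  Matrix.of fun a b => if octPerm (Fin.ofNat 6 (i / 4)) b = a then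
    ((2 * octPermSign (Fin.ofNat 6 (i / 4)) * octSign (Fin.ofNat 4 i) b : ℤ) : ZTheta) else 0

/-- The matrix that sends the basis vector `e_j` to `ε_j e_{σ j}`. -/
def signedPerm {R n : Type*} [Ring R] [DecidableEq n] (σ : Equiv.Perm n) (ε : n → ℤˣ) :
    Matrix n n R :=
  Matrix.of fun i j => if σ j = i then (((ε j : ℤˣ) : ℤ) : R) else 0

theorem signedPerm_mul {R n : Type*} [Ring R] [Fintype n] [DecidableEq n] (σ τ : Equiv.Perm n)
    (ε δ : n → ℤˣ) : (signedPerm σ ε * signedPerm τ δ : Matrix n n R) =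
      signedPerm (σ * τ) fun j => ε (τ j) * δ j := by
  ext1 i j
  rw [Matrix.mul_apply, Finset.sum_eq_single (τ j)]
  · simp [signedPerm]
  · intro b _ hb
    simp [signedPerm, Ne.symm hb]
  · simp

theorem half_two_smul_signedPerm (σ : Equiv.Perm (Fin 3)) (ε : Fin 3 → ℤˣ) :
    half ((2 : ZTheta) • signedPerm σ ε) = signedPerm σ ε := by
  ext1 i j
  simp [half, signedPerm, apply_ite toComplex, map_ofNat]

theorem det_signedPerm_eq_neg_one_or (σ : Equiv.Perm (Fin 3)) (ε : Fin 3 → ℤˣ) :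
    (signedPerm σ ε : Matrix _ _ ZTheta).det = -1 ∨
      ∃ i, (2 : ZTheta) • signedPerm σ ε = twiceOct i := by
  revert σ ε
  decide +kernel

theorem det_twiceOct (i : Fin 24) : (twiceOct i).det = 8 := by
  revert i
  decide +kernel

theorem exists_twiceOct_eq (i : Fin 24) :
    ∃ (σ : Equiv.Perm (Fin 3)) (ε : Fin 3 → ℤˣ), twiceOct i = (2 : ZTheta) • signedPerm σ ε := by
  revert i
  decide +kernel

theorem mem_octahedralMatrices {M : Matrix (Fin 3) (Fin 3) ℂ} :
    M ∈ octahedralMatrices ↔ ∃ i, M = half (twiceOct i) := by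
  constructor
  · rintro ⟨hdet, σ, ε, hM⟩
    replace hM : M = half ((2 : ZTheta) • signedPerm σ ε) :=
      hM.trans (half_two_smul_signedPerm σ ε).symm
    rcases det_signedPerm_eq_neg_one_or σ ε with hneg | ⟨i, hi⟩
    · rw [hM, det_half, Matrix.det_smul, hneg, Fintype.card_fin] at hdet
      norm_num [map_ofNat] at hdet
    · exact ⟨i, by rw [hM, hi]⟩
  · rintro ⟨i, rfl⟩
    obtain ⟨σ, ε, h⟩ := exists_twiceOct_eq i
    refine ⟨?_, σ, ε, by rw [h, half_two_smul_signedPerm]; rfl⟩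
    rw [det_half, det_twiceOct, map_ofNat]
    norm_num

theorem mul_mem_octahedralMatrices {M N : Matrix (Fin 3) (Fin 3) ℂ} (hM : M ∈ octahedralMatrices)
    (hN : N ∈ octahedralMatrices) : M * N ∈ octahedralMatrices := by
  obtain ⟨hdetM, σ, ε, hM⟩ := hM
  obtain ⟨hdetN, τ, δ, hN⟩ := hN
  refine ⟨by rw [Matrix.det_mul, hdetM, hdetN, mul_one], σ * τ, fun j => ε (τ j) * δ j, ?_⟩
  rw [hM, hN]
  exact signedPerm_mul σ τ ε δ

/-- The octahedral rotations as invertible matrices. -/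
noncomputable def octX (i : Fin 24) : GL (Fin 3) ℂ :=
  Matrix.GeneralLinearGroup.mkOfDetNeZero (half (twiceOct i)) <| by
    rw [(mem_octahedralMatrices.mpr ⟨i, rfl⟩).1]
    exact one_ne_zero

theorem coe_octX (i : Fin 24) : (octX i).1 = half (twiceOct i) := rfl

theorem octX_zero : octX 0 = 1 := by
  ext1
  rw [coe_octX, show twiceOct 0 = 2 by decide +kernel, half_two]
  rfl

theorem exists_octX_mul_octX_eq_one (i : Fin 24) : ∃ j, octX i * octX j = 1 := by
  have h (i : Fin 24) : ∃ j, twiceOct i * twiceOct j = (2 : ZTheta) • twiceOct 0 := by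
    revert i
    decide +kernel
  obtain ⟨j, hj⟩ := h i
  refine ⟨j, Units.ext ?_⟩
  rw [← octX_zero]
  exact half_mul hj

/-- The group of the octahedral rotations. -/
noncomputable def octahedralGroup : Subgroup (GL (Fin 3) ℂ) where
  carrier := Set.range octX
  one_mem' := ⟨0, octX_zero⟩
  mul_mem' := by
    rintro _ _ ⟨i, rfl⟩ ⟨j, rfl⟩
    obtain ⟨k, hk⟩ := mem_octahedralMatrices.mp (mul_mem_octahedralMatrices
      (mem_octahedralMatrices.mpr ⟨i, rfl⟩) (mem_octahedralMatrices.mpr ⟨j, rfl⟩))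
    exact ⟨k, Units.ext hk.symm⟩
  inv_mem' := by
    rintro _ ⟨i, rfl⟩
    obtain ⟨j, hj⟩ := exists_octX_mul_octX_eq_one i
    exact ⟨j, eq_inv_of_mul_eq_one_right hj⟩

theorem octX_mem_octahedralGroup (i : Fin 24) : octX i ∈ octahedralGroup := ⟨i, rfl⟩

theorem octX_mem_linearGroupX (i : Fin 24) : octX i ∈ linearGroupX :=
  Subgroup.subset_closure (Or.inl (mem_octahedralMatrices.mpr ⟨i, rfl⟩))

/-! ### The half-turns of the group -/

/-- The roots: vectors of squared length `4` that span the axes of the `21` half-turns. -/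
def root : Fin 21 → Fin 3 → ZTheta :=
  ![![0, ⟨0, 1⟩, ⟨0, 1⟩], ![0, ⟨0, 1⟩, ⟨0, -1⟩], ![⟨0, 1⟩, 0, ⟨0, 1⟩], ![⟨0, 1⟩, 0, ⟨0, -1⟩],
    ![⟨0, 1⟩, ⟨0, 1⟩, 0], ![⟨0, 1⟩, ⟨0, -1⟩, 0], ![2, 0, 0], ![0, 2, 0], ![0, 0, 2],
    ![⟨1, -1⟩, 1, 1], ![⟨1, -1⟩, 1, -1], ![⟨1, -1⟩, -1, 1], ![⟨1, -1⟩, -1, -1],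
    ![1, ⟨1, -1⟩, 1], ![1, ⟨1, -1⟩, -1], ![-1, ⟨1, -1⟩, 1], ![-1, ⟨1, -1⟩, -1],
    ![1, 1, ⟨1, -1⟩], ![1, -1, ⟨1, -1⟩], ![-1, 1, ⟨1, -1⟩], ![-1, -1, ⟨1, -1⟩]]

theorem star_root_dotProduct_root (i : Fin 21) : star (root i) ⬝ᵥ root i = 4 := by
  revert i
  decide +kernel

/-- The double of the half-turn about a root. -/
def twiceRefl (i : Fin 21) : Matrix (Fin 3) (Fin 3) ZTheta :=
  Matrix.vecMulVec (root i) (star (root i)) - 2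

/-- The complex vector of a root. -/
noncomputable def rootX (i : Fin 21) : Fin 3 → ℂ := toComplex ∘ root i

/-- The linear form whose value at a root is `2`. -/
noncomputable def corootX (i : Fin 21) : Fin 3 → ℂ := (1 / 2 : ℂ) • toComplex ∘ star (root i)

theorem corootX_dotProduct_rootX (i : Fin 21) : corootX i ⬝ᵥ rootX i = 2 := by
  have h := RingHom.map_dotProduct toComplex (star (root i)) (root i)
  rw [star_root_dotProduct_root, map_ofNat] at h
  rw [corootX, rootX, smul_dotProduct, ← h]
  norm_num

/-- The half-turns of the group, in the coordinates `x`. -/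
noncomputable def reflX (i : Fin 21) : GL (Fin 3) ℂ := halfTurn (corootX_dotProduct_rootX i)

theorem coe_reflX (i : Fin 21) : (reflX i).1 = half (twiceRefl i) := by
  have h2 := half_two
  rw [half] at h2
  rw [half, twiceRefl, Matrix.map_sub _ (map_sub toComplex), smul_sub, h2]
  change Matrix.vecMulVec (rootX i) (corootX i) - 1 = _
  rw [corootX, Matrix.vecMulVec_smul]
  congr 2
  ext1 a b
  simp [Matrix.vecMulVec_apply, rootX]

theorem reflX_mul_self (i : Fin 21) : reflX i * reflX i = 1 := halfTurn_mul_self _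

/-- The double of the matrix `Q`. -/
def twiceQ : Matrix (Fin 3) (Fin 3) ZTheta :=
  !![⟨1, 0⟩, ⟨1, 0⟩, ⟨0, -1⟩; ⟨1, 0⟩, ⟨1, 0⟩, ⟨0, 1⟩; ⟨1, -1⟩, ⟨-1, 1⟩, ⟨0, 0⟩]

theorem half_twiceQ : half twiceQ = matrixQ := by
  ext i j
  fin_cases i <;> fin_cases j <;> simp [half, twiceQ, matrixQ, toComplex_apply] <;> ring

theorem mul_eq_of_twice {g h k : GL (Fin 3) ℂ} {A B C : Matrix (Fin 3) (Fin 3) ZTheta}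
    (hg : g.1 = half A) (hh : h.1 = half B) (hk : k.1 = half C)
    (hABC : A * B = (2 : ZTheta) • C) : g * h = k :=
  Units.ext <| by rw [Units.val_mul, hg, hh, hk, half_mul hABC]

theorem matrixQ_eq : matrixQ = (reflX 18 * octX 8).1 := by
  rw [Units.val_mul, coe_reflX, coe_octX, ← half_twiceQ]
  exact (half_mul (by decide +kernel)).symm

theorem matrixQ_eq_reflX_mul_reflX : matrixQ = (reflX 5 * reflX 19).1 := by
  rw [Units.val_mul, coe_reflX, coe_reflX, ← half_twiceQ]
  exact (half_mul (by decide +kernel)).symm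

theorem reflX_mul_octX_mul_reflX (i : Fin 24) :
    (∃ a, reflX 18 * octX i * reflX 18 = octX a) ∨
      ∃ a b, reflX 18 * octX i * reflX 18 = octX a * reflX 18 * octX b := by
  let a : Fin 24 → Fin 24 :=
    ![0, 1, 1, 8, 13, 5, 5, 13, 3, 1, 1, 11, 12, 4, 4, 12, 13, 5, 5, 13, 12, 4, 4, 12]
  let b : Fin 24 → Fin 24 :=
    ![0, 1, 10, 0, 18, 5, 18, 5, 0, 9, 2, 0, 22, 13, 22, 13, 17, 17, 6, 6, 21, 21, 14, 14]
  have h (i : Fin 24) :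
      twiceRefl 18 * twiceOct i * twiceRefl 18 = (4 : ZTheta) • twiceOct (a i) ∨
        twiceRefl 18 * twiceOct i * twiceRefl 18 =
          twiceOct (a i) * twiceRefl 18 * twiceOct (b i) := by
    revert i
    decide +kernel
  refine (h i).imp (fun h => ⟨a i, Units.ext ?_⟩) fun h => ⟨a i, b i, Units.ext ?_⟩
  · simp only [Units.val_mul, coe_reflX, coe_octX, half_mul_mul, h, half_smul, map_ofNat, smul_smul]
    norm_num
  · simp only [Units.val_mul, coe_reflX, coe_octX, half_mul_mul, h]

theorem reflX_eq_octX_or (i : Fin 21) :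
    (∃ a, reflX i = octX a) ∨ ∃ a b, reflX i = octX a * reflX 18 * octX b := by
  let a : Fin 21 → Fin 24 :=
    ![5, 4, 22, 20, 11, 8, 1, 2, 3, 14, 12, 15, 13, 6, 4, 7, 5, 2, 0, 3, 1]
  let b : Fin 21 → Fin 24 :=
    ![0, 0, 0, 0, 0, 0, 0, 0, 0, 19, 16, 17, 18, 7, 4, 6, 5, 2, 0, 3, 1]
  have h (i : Fin 21) : twiceRefl i = twiceOct (a i) ∨
      (4 : ZTheta) • twiceRefl i = twiceOct (a i) * twiceRefl 18 * twiceOct (b i) := by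
    revert i
    decide +kernel
  refine (h i).imp (fun h => ⟨a i, Units.ext ?_⟩) fun h => ⟨a i, b i, Units.ext ?_⟩
  · rw [coe_reflX, coe_octX, h]
  · simp only [Units.val_mul, coe_reflX, coe_octX, half_mul_mul, ← h, half_smul, map_ofNat,
      smul_smul]
    norm_num

theorem octX_eq_reflX_mul_reflX (i : Fin 24) : ∃ a b, octX i = reflX a * reflX b := by
  let a : Fin 24 → Fin 21 :=
    ![0, 0, 2, 4, 0, 1, 0, 0, 4, 4, 4, 5, 1, 0, 1, 0, 1, 0, 0, 1, 2, 2, 3, 2]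
  let b : Fin 24 → Fin 21 :=
    ![0, 1, 3, 5, 6, 6, 8, 7, 8, 7, 6, 8, 3, 2, 2, 3, 5, 4, 5, 4, 7, 8, 7, 6]
  have h (i : Fin 24) : twiceRefl (a i) * twiceRefl (b i) = (2 : ZTheta) • twiceOct i := by
    revert i
    decide +kernel
  exact ⟨a i, b i, (mul_eq_of_twice (coe_reflX _) (coe_reflX _) (coe_octX i) (h i)).symm⟩

theorem exists_reflX_mul_reflX_transitive (i : Fin 21) : ∃ a b, ∃ s : ℤˣ,
    (reflX a * reflX b).1 *ᵥ rootX 0 = ((s : ℤ) : ℂ) • rootX i ∧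
      corootX i ᵥ* (reflX a * reflX b).1 = ((s : ℤ) : ℂ) • corootX 0 := by
  let a : Fin 21 → Fin 21 :=
    ![0, 0, 0, 0, 0, 0, 0, 4, 2, 2, 0, 0, 3, 2, 0, 3, 0, 2, 0, 3, 0]
  let b : Fin 21 → Fin 21 :=
    ![0, 7, 2, 3, 4, 5, 9, 9, 9, 16, 15, 13, 14, 18, 14, 20, 16, 13, 18, 15, 20]
  have h (i : Fin 21) : ∃ s : ℤˣ,
      (twiceRefl (a i) * twiceRefl (b i)) *ᵥ root 0 = ((4 * s : ℤ) : ZTheta) • root i ∧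
        star (root i) ᵥ* (twiceRefl (a i) * twiceRefl (b i)) =
          ((4 * s : ℤ) : ZTheta) • star (root 0) := by
    revert i
    decide +kernel
  obtain ⟨s, hroot, hcoroot⟩ := h i
  refine ⟨a i, b i, s, ?_, ?_⟩ <;> funext j
  · have hj := congrArg toComplex (congrFun hroot j)
    rw [RingHom.map_mulVec] at hj
    rw [Units.val_mul, coe_reflX, coe_reflX, half_mul_half, half, smul_smul, Matrix.smul_mulVec,
      Pi.smul_apply, rootX, hj]
    simp [rootX, map_ofNat]
    ring
  · have hj := congrArg toComplex (congrFun hcoroot j)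
    rw [RingHom.map_vecMul] at hj
    rw [Units.val_mul, coe_reflX, coe_reflX, half_mul_half, half, smul_smul, Matrix.vecMul_smul,
      Pi.smul_apply, corootX, Matrix.smul_vecMul, Pi.smul_apply, hj]
    simp [corootX, map_ofNat]
    ring

theorem mem_or_exists_eq_mul_mul_of_mem_closure {G : Type*} [Group G] {H : Subgroup G} {r : G}
    (hr : r * r = 1)
    (hrr : ∀ x ∈ H, r * x * r ∈ H ∨ ∃ y ∈ H, ∃ z ∈ H, r * x * r = y * r * z) {g : G}
    (hg : g ∈ Subgroup.closure (insert r (H : Set G))) :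
    g ∈ H ∨ ∃ x ∈ H, ∃ y ∈ H, g = x * r * y := by
  have hmul (x : G) (hx : x ∈ insert r (H : Set G)) (y : G)
      (hy : y ∈ H ∨ ∃ a ∈ H, ∃ b ∈ H, y = a * r * b) :
      x * y ∈ H ∨ ∃ a ∈ H, ∃ b ∈ H, x * y = a * r * b := by
    rcases hx with rfl | hx <;> rcases hy with hy | ⟨a, ha, b, hb, rfl⟩
    · exact Or.inr ⟨1, one_mem H, y, hy, by rw [one_mul]⟩
    · have hassoc : x * (a * x * b) = x * a * x * b := by simp only [mul_assoc]
      rw [hassoc]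
      rcases hrr a ha with hmem | ⟨c, hc, d, hd, heq⟩
      · exact Or.inl (mul_mem hmem hb)
      · exact Or.inr ⟨c, hc, d * b, mul_mem hd hb, by rw [heq, mul_assoc]⟩
    · exact Or.inl (mul_mem hx hy)
    · exact Or.inr ⟨x * a, mul_mem hx ha, b, hb, by simp only [mul_assoc]⟩
  refine Subgroup.closure_induction_left (Or.inl (one_mem H)) (fun x hx y _ => hmul x hx y)
    (fun x hx y _ => hmul x⁻¹ ?_ y) hg
  rcases hx with rfl | hx
  · exact Or.inl (eq_inv_of_mul_eq_one_left hr).symm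
  · exact Or.inr (inv_mem hx)

theorem linearGroupX_le_closure :
    linearGroupX ≤ Subgroup.closure (insert (reflX 18) (octahedralGroup : Set (GL (Fin 3) ℂ))) := by
  refine (Subgroup.closure_le _).mpr ?_
  have hoct (i : Fin 24) :
      octX i ∈ Subgroup.closure (insert (reflX 18) (octahedralGroup : Set (GL (Fin 3) ℂ))) :=
    Subgroup.subset_closure (Or.inr (octX_mem_octahedralGroup i))
  rintro g (hg | hg)
  · obtain ⟨i, hi⟩ := mem_octahedralMatrices.mp hg
    rw [show g = octX i from Units.ext hi]
    exact hoct i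
  · rw [show g = reflX 18 * octX 8 from Units.ext (hg.trans matrixQ_eq)]
    exact mul_mem (Subgroup.subset_closure (Or.inl rfl)) (hoct 8)

theorem mem_octahedralGroup_or_of_mem_linearGroupX {g : GL (Fin 3) ℂ} (hg : g ∈ linearGroupX) :
    g ∈ octahedralGroup ∨
      ∃ x ∈ octahedralGroup, ∃ y ∈ octahedralGroup, g = x * reflX 18 * y := by
  refine mem_or_exists_eq_mul_mul_of_mem_closure (reflX_mul_self 18) ?_ (linearGroupX_le_closure hg)
  rintro _ ⟨i, rfl⟩
  rcases reflX_mul_octX_mul_reflX i with ⟨a, h⟩ | ⟨a, b, h⟩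
  · exact Or.inl ⟨a, h.symm⟩
  · exact Or.inr ⟨octX a, ⟨a, rfl⟩, octX b, ⟨b, rfl⟩, h⟩

theorem reflX_mem_linearGroupX (i : Fin 21) : reflX i ∈ linearGroupX := by
  have hr : reflX 18 * octX 8 ∈ linearGroupX := Subgroup.subset_closure (Or.inr matrixQ_eq.symm)
  replace hr := (mul_mem_cancel_right (octX_mem_linearGroupX 8)).mp hr
  rcases reflX_eq_octX_or i with ⟨a, h⟩ | ⟨a, b, h⟩ <;> rw [h]
  · exact octX_mem_linearGroupX a
  · exact mul_mem (mul_mem (octX_mem_linearGroupX a) hr) (octX_mem_linearGroupX b)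

theorem linearGroupX_le_closure_reflX : linearGroupX ≤ Subgroup.closure (Set.range reflX) := by
  refine (Subgroup.closure_le _).mpr ?_
  have hmul (a b : Fin 21) : reflX a * reflX b ∈ Subgroup.closure (Set.range reflX) :=
    mul_mem (Subgroup.subset_closure ⟨a, rfl⟩) (Subgroup.subset_closure ⟨b, rfl⟩)
  rintro g (hg | hg)
  · obtain ⟨i, hi⟩ := mem_octahedralMatrices.mp hg
    obtain ⟨a, b, h⟩ := octX_eq_reflX_mul_reflX i
    rw [show g = reflX a * reflX b from Units.ext (hi.trans (congrArg Units.val h))]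
    exact hmul a b
  · rw [show g = reflX 5 * reflX 19 from Units.ext (hg.trans matrixQ_eq_reflX_mul_reflX)]
    exact hmul 5 19

theorem mul_self_eq_smul_one_of_mem_center {g : GL (Fin 3) ℂ} {c : ℂ} (hc : c ≠ 0)
    {A : Matrix (Fin 3) (Fin 3) ZTheta} (hg : g.1 = c • half A)
    (hgg : g * g ∈ Subgroup.center _) : A * A = (A * A) 0 0 • 1 := by
  obtain ⟨u, hu⟩ := coe_eq_smul_one_of_mk_eq_one (Matrix.ProjGenLinGroup.mk_eq_one.mpr hgg)
  refine eq_smul_one_of_half_eq_smul_one (c := (c * c * (1 / 2))⁻¹ * u) ?_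
  rw [Units.val_mul, hg, smul_mul_smul_comm, half_mul_half, smul_smul] at hu
  rw [mul_smul, ← hu, inv_smul_smul₀ (mul_ne_zero (mul_ne_zero hc hc) (by norm_num))]

theorem octX_eq_one_or_of_mul_self_mem_center {i : Fin 24}
    (hc : octX i * octX i ∈ Subgroup.center _) : octX i = 1 ∨ ∃ j, octX i = reflX j := by
  have h (i : Fin 24) : twiceOct i * twiceOct i ≠ (twiceOct i * twiceOct i) 0 0 • 1 ∨
      twiceOct i = 2 ∨ ∃ j, twiceOct i = twiceRefl j := by
    revert i
    decide +kernel
  refine ((h i).resolve_left (not_not_intro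
    (mul_self_eq_smul_one_of_mem_center one_ne_zero (by rw [one_smul, coe_octX]) hc))).imp
    (fun h => Units.ext ?_) fun ⟨j, h⟩ => ⟨j, Units.ext ?_⟩
  · rw [coe_octX, h, half_two, Units.val_one]
  · rw [coe_octX, h, coe_reflX]

theorem octX_mul_reflX_eq_of_mul_self_mem_center {i : Fin 24}
    (hc : octX i * reflX 18 * (octX i * reflX 18) ∈ Subgroup.center _) :
    octX i * reflX 18 = reflX 18 ∨ octX i * reflX 18 = reflX 19 := by
  have h (i : Fin 24) (A : Matrix (Fin 3) (Fin 3) ZTheta) (hA : A = twiceOct i * twiceRefl 18) :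
      A * A ≠ (A * A) 0 0 • 1 ∨ A = (2 : ZTheta) • twiceRefl 18 ∨
        A = (2 : ZTheta) • twiceRefl 19 := by
    subst hA
    revert i
    decide +kernel
  have hsq := mul_self_eq_smul_one_of_mem_center (A := twiceOct i * twiceRefl 18)
    (one_div_ne_zero two_ne_zero)
    (by rw [Units.val_mul, coe_octX, coe_reflX, half_mul_half]) hc
  exact ((h i _ rfl).resolve_left (not_not_intro hsq)).imp
    (mul_eq_of_twice (coe_octX i) (coe_reflX 18) (coe_reflX 18))
    (mul_eq_of_twice (coe_octX i) (coe_reflX 18) (coe_reflX 19))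

theorem exists_octX_mul_reflX_eq (i : Fin 24) (j : Fin 21) (hj : j = 18 ∨ j = 19) :
    ∃ k, octX i * reflX j = reflX k * octX i := by
  have h (i : Fin 24) (j : Fin 21) (hj : j = 18 ∨ j = 19) :
      ∃ k, twiceOct i * twiceRefl j = twiceRefl k * twiceOct i := by
    revert i j
    decide +kernel
  obtain ⟨k, hk⟩ := h i j hj
  refine ⟨k, Units.ext ?_⟩
  simp only [Units.val_mul, coe_reflX, coe_octX, half_mul_half, hk]

theorem eq_one_or_exists_eq_reflX {g : GL (Fin 3) ℂ} (hg : g ∈ linearGroupX)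
    (hc : g * g ∈ Subgroup.center _) : g = 1 ∨ ∃ j, g = reflX j := by
  rcases mem_octahedralGroup_or_of_mem_linearGroupX hg with ⟨i, rfl⟩ | ⟨x, hx, y, hy, rfl⟩
  · exact octX_eq_one_or_of_mul_self_mem_center hc
  · obtain ⟨i, hi⟩ := mul_mem hy hx
    obtain ⟨k, hk⟩ := inv_mem hy
    have hconj : x * reflX 18 * y = octX k * (octX i * reflX 18) * (octX k)⁻¹ := by
      rw [hi, hk]
      group
    have hsq : octX i * reflX 18 * (octX i * reflX 18) ∈ Subgroup.center _ := by
      rw [hconj] at hc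
      have := (Subgroup.center (GL (Fin 3) ℂ)).normal_of_characteristic.conj_mem _ hc (octX k)⁻¹
      simpa [mul_assoc] using this
    obtain ⟨j, hj, hij⟩ : ∃ j : Fin 21, (j = 18 ∨ j = 19) ∧ octX i * reflX 18 = reflX j :=
      (octX_mul_reflX_eq_of_mul_self_mem_center hsq).elim
        (fun h => ⟨18, Or.inl rfl, h⟩) fun h => ⟨19, Or.inr rfl, h⟩
    obtain ⟨l, hl⟩ := exists_octX_mul_reflX_eq k j hj
    exact Or.inr ⟨l, by rw [hconj, hij, hl, mul_inv_cancel_right]⟩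

/-! ### The reflection lines -/

/-- The isolated fixed point of a half-turn, in the coordinates `y`. -/
noncomputable def reflCenter (i : Fin 21) : Fin 3 → ℂ := (coordChange⁻¹).1 *ᵥ rootX i

/-- The linear form that defines the axis of a half-turn, in the coordinates `y`. -/
noncomputable def reflForm (i : Fin 21) : Fin 3 → ℂ := corootX i ᵥ* coordChange.1

theorem reflForm_dotProduct_reflCenter (i : Fin 21) : reflForm i ⬝ᵥ reflCenter i = 2 := by
  rw [reflForm, reflCenter, ← Matrix.dotProduct_mulVec, Matrix.mulVec_mulVec, Units.mul_inv,
    Matrix.one_mulVec, corootX_dotProduct_rootX]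

theorem reflForm_ne_zero (i : Fin 21) : reflForm i ≠ 0 := fun h =>
  two_ne_zero ((reflForm_dotProduct_reflCenter i).symm.trans (by rw [h, zero_dotProduct]))

/-- The half-turns of the group, in the coordinates `y`. -/
noncomputable def refl (i : Fin 21) : GL (Fin 3) ℂ := halfTurn (reflForm_dotProduct_reflCenter i)

theorem refl_mulVec (i : Fin 21) (v : Fin 3 → ℂ) :
    (refl i).1 *ᵥ v = (reflForm i ⬝ᵥ v) • reflCenter i - v :=
  halfTurn_mulVec _ v

theorem refl_eq (i : Fin 21) : refl i = coordChange⁻¹ * reflX i * coordChange := by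
  rw [mul_assoc, eq_inv_mul_iff_mul_eq]
  refine mul_halfTurn _ _ (s := 1) ?_ ?_
  · rw [reflCenter, Matrix.mulVec_mulVec, Units.mul_inv, Matrix.one_mulVec, one_smul]
  · rw [reflForm, one_smul]

theorem mem_linearGroup_iff {g : GL (Fin 3) ℂ} :
    g ∈ linearGroup ↔ coordChange * g * coordChange⁻¹ ∈ linearGroupX := Iff.rfl

theorem refl_mem_linearGroup (i : Fin 21) : refl i ∈ linearGroup := by
  rw [mem_linearGroup_iff, refl_eq]
  simpa only [mul_assoc, mul_inv_cancel_left, mul_inv_cancel, mul_one] using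
    reflX_mem_linearGroupX i

theorem linearGroup_le_closure_refl : linearGroup ≤ Subgroup.closure (Set.range refl) := by
  intro g hg
  have hle : Subgroup.closure (Set.range reflX) ≤
      (Subgroup.closure (Set.range refl)).comap (MulAut.conj coordChange⁻¹).toMonoidHom := by
    rw [Subgroup.closure_le, Set.range_subset_iff]
    intro i
    refine Subgroup.subset_closure ⟨i, ?_⟩
    simp [refl_eq]
  simpa [Subgroup.mem_comap, mul_assoc] using
    hle (linearGroupX_le_closure_reflX (mem_linearGroup_iff.mp hg))

theorem eq_one_or_exists_eq_refl {g : GL (Fin 3) ℂ} (hg : g ∈ linearGroup)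
    (hc : g * g ∈ Subgroup.center (GL (Fin 3) ℂ)) : g = 1 ∨ ∃ j, g = refl j := by
  have hsq : coordChange * g * coordChange⁻¹ * (coordChange * g * coordChange⁻¹) ∈
      Subgroup.center (GL (Fin 3) ℂ) := by
    have hconj := Subgroup.normal_of_characteristic (Subgroup.center (GL (Fin 3) ℂ))
      |>.conj_mem _ hc coordChange
    simpa only [mul_assoc, inv_mul_cancel_left] using hconj
  rcases eq_one_or_exists_eq_reflX (mem_linearGroup_iff.mp hg) hsq with hone | ⟨j, hj⟩
  · exact .inl (by simpa [mul_inv_eq_one] using hone)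
  · exact .inr ⟨j, by rw [refl_eq, ← hj]; group⟩

theorem exists_mem_linearGroup_mul_refl_eq (i : Fin 21) : ∃ k ∈ linearGroup, ∃ s : ℂ, s ≠ 0 ∧
    k * refl 0 = refl i * k ∧ reflForm i ᵥ* k.1 = s • reflForm 0 := by
  obtain ⟨a, b, s, hroot, hcoroot⟩ := exists_reflX_mul_reflX_transitive i
  have hk : refl a * refl b = coordChange⁻¹ * (reflX a * reflX b) * coordChange := by
    rw [refl_eq, refl_eq]
    group
  have hform : reflForm i ᵥ* (refl a * refl b).1 = ((s : ℤ) : ℂ) • reflForm 0 := by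
    rw [hk, reflForm, reflForm, Matrix.vecMul_vecMul, ← Units.val_mul, mul_assoc,
      mul_inv_cancel_left, Units.val_mul, ← Matrix.vecMul_vecMul, hcoroot, Matrix.smul_vecMul]
  have hcenter : (refl a * refl b).1 *ᵥ reflCenter 0 = ((s : ℤ) : ℂ) • reflCenter i := by
    rw [hk, reflCenter, reflCenter, Matrix.mulVec_mulVec, ← Units.val_mul, mul_assoc,
      mul_inv_cancel, mul_one, Units.val_mul, ← Matrix.mulVec_mulVec, hroot, Matrix.mulVec_smul]
  exact ⟨_, mul_mem (refl_mem_linearGroup a) (refl_mem_linearGroup b), (s : ℤ),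
    mod_cast s.ne_zero, mul_halfTurn _ _ hcenter hform, hform⟩

theorem star_root_not_proportional {i j : Fin 21} (hij : i ≠ j) :
    ∃ a b, star (root i) a * star (root j) b ≠ star (root i) b * star (root j) a := by
  revert i j
  decide +kernel

theorem reflForm_ne_smul_reflForm {i j : Fin 21} (hij : i ≠ j) (s : ℂ) :
    reflForm i ≠ s • reflForm j := by
  intro h
  obtain ⟨a, b, hab⟩ := star_root_not_proportional hij
  have hcoroot : corootX i = s • corootX j := by
    have hmul := congrArg (· ᵥ* (coordChange⁻¹).1) h
    simpa only [reflForm, Matrix.smul_vecMul, Matrix.vecMul_vecMul, Units.mul_inv,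
      Matrix.vecMul_one] using hmul
  have hentry (k : Fin 3) : toComplex (star (root i) k) = s * toComplex (star (root j) k) := by
    have hk := congrFun hcoroot k
    simp only [corootX, Pi.smul_apply, Function.comp_apply, smul_eq_mul] at hk
    linear_combination 2 * hk
  apply hab
  apply toComplex_injective
  rw [map_mul, map_mul, hentry, hentry]
  ring

theorem mk_mem_projLine {a v : Fin 3 → ℂ} (hv : v ≠ 0) :
    Projectivization.mk ℂ v hv ∈ projLine a ↔ a ⬝ᵥ v = 0 := by
  obtain ⟨c, hc⟩ := Projectivization.exists_smul_eq_mk_rep ℂ v hv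
  change a ⬝ᵥ (Projectivization.mk ℂ v hv).rep = 0 ↔ _
  rw [← hc, Units.smul_def, dotProduct_smul, smul_eq_mul, mul_eq_zero_iff_left c.ne_zero]

theorem projLine_smul {s : ℂ} (hs : s ≠ 0) (a : Fin 3 → ℂ) : projLine (s • a) = projLine a := by
  ext p
  change (s • a) ⬝ᵥ p.rep = 0 ↔ a ⬝ᵥ p.rep = 0
  rw [smul_dotProduct, smul_eq_mul, mul_eq_zero_iff_left hs]

theorem exists_eq_smul_of_projLine_subset {a b : Fin 3 → ℂ} (h : projLine a ⊆ projLine b) :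
    ∃ s : ℂ, b = s • a := by
  refine exists_eq_smul_of_forall_dotProduct_eq_zero fun v hav => ?_
  rcases eq_or_ne v 0 with rfl | hv
  · exact dotProduct_zero b
  · exact (mk_mem_projLine hv).mp (h ((mk_mem_projLine hv).mpr hav))

theorem isReflectionForm_reflForm (i : Fin 21) : IsReflectionForm (reflForm i) := by
  refine ⟨reflForm_ne_zero i, Matrix.ProjGenLinGroup.mk (refl i),
    ⟨refl i, refl_mem_linearGroup i, rfl⟩, mk_halfTurn_ne_one _ (by decide), ?_, ?_⟩
  · rw [← map_mul, refl, halfTurn_mul_self, map_one]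
  · intro p hp
    induction p using Projectivization.ind with
    | h v hv => exact mk_halfTurn_smul_mk _ hv ((mk_mem_projLine hv).mp hp)

theorem exists_eq_smul_reflForm {a : Fin 3 → ℂ} (ha : IsReflectionForm a) :
    ∃ i, ∃ s : ℂ, s ≠ 0 ∧ a = s • reflForm i := by
  obtain ⟨-, T, ⟨g, hg, rfl⟩, hne, hsq, hfix⟩ := ha
  rw [← map_mul, Matrix.ProjGenLinGroup.mk_eq_one] at hsq
  rcases eq_one_or_exists_eq_refl hg hsq with rfl | ⟨j, rfl⟩
  · exact absurd (map_one _) hne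
  obtain ⟨s, hs⟩ := exists_eq_smul_of_forall_mk_halfTurn_smul (reflForm_dotProduct_reflCenter j)
    (by decide) fun v hv hav => hfix _ ((mk_mem_projLine hv).mpr hav)
  have hs0 : s ≠ 0 := by
    rintro rfl
    exact reflForm_ne_zero j (hs.trans (zero_smul ℂ a))
  exact ⟨j, s⁻¹, inv_ne_zero hs0, by rw [hs, inv_smul_smul₀ hs0]⟩

theorem reflectionLines_eq : reflectionLines = Set.range fun i => projLine (reflForm i) := by
  ext L
  constructor
  · rintro ⟨a, ha, rfl⟩
    obtain ⟨i, s, hs, rfl⟩ := exists_eq_smul_reflForm ha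
    exact ⟨i, (projLine_smul hs _).symm⟩
  · rintro ⟨i, rfl⟩
    exact ⟨reflForm i, isReflectionForm_reflForm i, rfl⟩

theorem projLine_reflForm_injective : Function.Injective fun i => projLine (reflForm i) := by
  intro i j h
  by_contra hij
  obtain ⟨s, hs⟩ := exists_eq_smul_of_projLine_subset h.superset
  exact reflForm_ne_smul_reflForm hij s hs

theorem reflectionLines_ncard : reflectionLines.ncard = 21 := by
  rw [reflectionLines_eq, ← Set.image_univ,
    Set.ncard_image_of_injective _ projLine_reflForm_injective, Set.ncard_univ, Nat.card_fin]

/-! ### The basic invariants and equivariants -/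

/-- The partial derivative of a term of `ofTerms`. -/
def derivTerm (i : Fin 3) (t : ℤ × ℕ × ℕ × ℕ) : ℤ × ℕ × ℕ × ℕ :=
  ![(t.1 * t.2.1, t.2.1 - 1, t.2.2.1, t.2.2.2), (t.1 * t.2.2.1, t.2.1, t.2.2.1 - 1, t.2.2.2),
    (t.1 * t.2.2.2, t.2.1, t.2.2.1, t.2.2.2 - 1)] i

theorem ofTerms_cons (t : ℤ × ℕ × ℕ × ℕ) (L : List (ℤ × ℕ × ℕ × ℕ)) :
    ofTerms (t :: L) =
      C (t.1 : ℂ) * X 0 ^ t.2.1 * X 1 ^ t.2.2.1 * X 2 ^ t.2.2.2 + ofTerms L := by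
  rw [ofTerms, List.map_cons, List.sum_cons, ofTerms]

theorem pderiv_ofTerms (i : Fin 3) (L : List (ℤ × ℕ × ℕ × ℕ)) :
    pderiv i (ofTerms L) = ofTerms (L.map (derivTerm i)) := by
  induction L with
  | nil => exact map_zero _
  | cons t L ih =>
    rw [List.map_cons, ofTerms_cons, ofTerms_cons, map_add, ih]
    congr 1
    fin_cases i <;> simp [derivTerm, pderiv_X] <;> ring

theorem eval_ofTerms (v : Fin 3 → ℂ) (L : List (ℤ × ℕ × ℕ × ℕ)) :
    eval v (ofTerms L) =
      (L.map fun t => (t.1 : ℂ) * v 0 ^ t.2.1 * v 1 ^ t.2.2.1 * v 2 ^ t.2.2.2).sum := by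
  induction L with
  | nil => exact map_zero _
  | cons t L ih =>
    rw [ofTerms_cons, List.map_cons, List.sum_cons, ← ih]
    simp

theorem isHomogeneous_ofTerms {L : List (ℤ × ℕ × ℕ × ℕ)} {n : ℕ}
    (h : ∀ t ∈ L, t.2.1 + t.2.2.1 + t.2.2.2 = n) : (ofTerms L).IsHomogeneous n := by
  induction L with
  | nil => exact isHomogeneous_zero _ _ _
  | cons t L ih =>
    rw [ofTerms_cons, ← h t List.mem_cons_self]
    refine IsHomogeneous.add ?_ ((h t List.mem_cons_self).symm ▸
      ih fun t ht => h t (List.mem_cons_of_mem _ ht))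
    exact ((isHomogeneous_C_mul_X_pow _ _ _).mul (isHomogeneous_X_pow _ _)).mul
      (isHomogeneous_X_pow _ _)

theorem isHomogeneous_polyF : polyF.IsHomogeneous 4 := isHomogeneous_ofTerms (by decide)

theorem polyPhi_eq : polyPhi = ofTerms [(26, 6, 0, 0), (210, 5, 0, 1), (330, 4, 2, 0),
    (315, 4, 0, 2), (-420, 3, 2, 1), (980, 3, 0, 3), (-90, 2, 4, 0), (630, 2, 2, 2),
    (-3675, 2, 0, 4), (-630, 1, 4, 1), (-2940, 1, 2, 3), (54, 0, 6, 0), (315, 0, 4, 2),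
    (-3675, 0, 2, 4), (686, 0, 0, 6)] := by
  refine MvPolynomial.funext fun v => ?_
  simp only [polyPhi, hessianF, Matrix.det_fin_three, Matrix.of_apply, polyF, pderiv_ofTerms,
    map_mul, map_add, map_sub, eval_C, eval_ofTerms, derivTerm, List.map_cons, List.map_nil,
    List.sum_cons, List.sum_nil, Matrix.cons_val]
  push_cast
  ring

theorem isHomogeneous_polyPhi : polyPhi.IsHomogeneous 6 :=
  polyPhi_eq ▸ isHomogeneous_ofTerms (by decide)

theorem mapG9_eq : mapG9 =
    C (σ := Fin 3) (1 / 756 : ℂ) • adjHessianGradient polyF polyPhi - polyF ^ 2 • X := by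
  refine funext fun i => MvPolynomial.funext fun v => ?_
  fin_cases i <;>
  · simp only [mapG9, adjHessianGradient, Matrix.adjugate_fin_three, hessian, gradient,
      Matrix.mulVec, dotProduct, Fin.sum_univ_three, Pi.sub_apply, Pi.smul_apply, smul_eq_mul,
      Fin.zero_eta, Fin.mk_one, Fin.reduceFinMk, Matrix.of_apply, Matrix.cons_val, polyF,
      polyPhi_eq, pderiv_ofTerms, map_mul, map_add, map_sub, map_pow, map_neg, eval_C, eval_X,
      eval_ofTerms, derivTerm, List.map_cons, List.map_nil, List.sum_cons, List.sum_nil]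
    push_cast
    ring

theorem mapG11_eq : mapG11 = C (σ := Fin 3) (1 / 6300 : ℂ) • adjHessianGradient polyPhi polyF -
    (47 * polyF * polyPhi) • X := by
  refine funext fun i => MvPolynomial.funext fun v => ?_
  fin_cases i <;>
  · simp only [mapG11, adjHessianGradient, Matrix.adjugate_fin_three, hessian, gradient,
      Matrix.mulVec, dotProduct, Fin.sum_univ_three, Pi.sub_apply, Pi.smul_apply, smul_eq_mul,
      Fin.zero_eta, Fin.mk_one, Fin.reduceFinMk, Matrix.of_apply, Matrix.cons_val, polyF,
      polyPhi_eq, pderiv_ofTerms, map_mul, map_add, map_sub, map_neg, map_ofNat, eval_C, eval_X,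
      eval_ofTerms, derivTerm, List.map_cons, List.map_nil, List.sum_cons, List.sum_nil]
    push_cast
    ring

theorem det_bordered {R : Type*} [CommRing R] (p q : MvPolynomial (Fin 3) R) :
    (bordered p q).det = -(gradient q ⬝ᵥ adjHessianGradient p q) := by
  have hreindex : bordered p q =
      (Matrix.of ![![hessian p 0 0, hessian p 0 1, hessian p 0 2, gradient q 0],
        ![hessian p 1 0, hessian p 1 1, hessian p 1 2, gradient q 1],
        ![hessian p 2 0, hessian p 2 1, hessian p 2 2, gradient q 2],
        ![gradient q 0, gradient q 1, gradient q 2, 0]]).submatrix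
      (((Equiv.refl _).sumCongr (Equiv.ofUnique Unit (Fin 1))).trans finSumFinEquiv)
      (((Equiv.refl _).sumCongr (Equiv.ofUnique Unit (Fin 1))).trans finSumFinEquiv) := by
    ext1 (i | i) (j | j) <;> fin_cases i <;> fin_cases j <;> rfl
  rw [hreindex, Matrix.det_submatrix_equiv_self, adjHessianGradient, Matrix.adjugate_fin_three,
    Matrix.det_succ_row_zero]
  simp [Fin.sum_univ_succ, Matrix.det_fin_three, Fin.succAbove, Matrix.mulVec, dotProduct]
  ring

theorem polyPsi_eq : polyPsi =
    C (1 / 12) * (gradient polyPhi ⬝ᵥ mapG9) + C (1 / 2) * (polyF ^ 2 * polyPhi) := by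
  have heuler : gradient polyPhi ⬝ᵥ X = 6 * polyPhi := by
    have h := isHomogeneous_polyPhi.sum_X_mul_pderiv
    rw [nsmul_eq_mul] at h
    rw [dotProduct_comm]
    exact_mod_cast h
  have hadj : adjHessianGradient polyF polyPhi =
      C (σ := Fin 3) (756 : ℂ) • (mapG9 + polyF ^ 2 • X) := by
    rw [mapG9_eq, sub_add_cancel, smul_smul, ← C_mul]
    norm_num
  change C (-1 / 9072) * (bordered polyF polyPhi).det = _
  rw [det_bordered, hadj, dotProduct_smul, dotProduct_add, dotProduct_smul, heuler]
  refine MvPolynomial.funext fun v => ?_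
  simp only [smul_eq_mul, map_mul, map_add, map_neg, map_pow, map_ofNat, eval_C]
  ring

theorem isHomogeneous_mapG9 (i : Fin 3) : (mapG9 i).IsHomogeneous 9 := by
  fin_cases i <;> exact isHomogeneous_ofTerms (by decide)

theorem isHomogeneous_mapG11 (i : Fin 3) : (mapG11 i).IsHomogeneous 11 := by
  fin_cases i <;> exact isHomogeneous_ofTerms (by decide)

theorem isHomogeneous_polyPsi : polyPsi.IsHomogeneous 14 := by
  rw [polyPsi_eq]
  refine IsHomogeneous.add (.C_mul (.sum _ _ _ fun i _ => ?_) _) (.C_mul ?_ _)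
  · exact isHomogeneous_polyPhi.pderiv.mul (isHomogeneous_mapG9 i)
  · exact (isHomogeneous_polyF.pow 2).mul isHomogeneous_polyPhi

theorem isHomogeneous_mapH (i : Fin 3) : (mapH i).IsHomogeneous 15 := by
  have hF := isHomogeneous_polyF
  have hPhi := isHomogeneous_polyPhi
  exact (((((hF.pow 2).C_mul _).mul hPhi).add (isHomogeneous_polyPsi.C_mul _)).mul
    (isHomogeneous_X ℂ i)).add ((hPhi.C_mul _).mul (isHomogeneous_mapG9 i)) |>.add
    ((hF.C_mul _).mul (isHomogeneous_mapG11 i))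

/-! ### Invariance under the group -/

theorem mem_commutant_mapH {g : GL (Fin 3) ℂ} (hdet : g.1.det = 1)
    (hF : linearSubst g.1 polyF = polyF) : g ∈ commutant mapH := by
  have hC (c : ℂ) : linearSubst g.1 (C c) = C c := bind₁_C_right _ c
  have hPhi : linearSubst g.1 polyPhi = polyPhi := by
    have h := det_hessian_linearSubst g.1 polyF
    rw [hF, hdet, one_pow, C_1, one_mul] at h
    rw [polyPhi, map_mul, hC]
    exact congrArg (C _ * ·) h.symm
  have hPsi : linearSubst g.1 polyPsi = polyPsi := by
    have h := det_bordered_linearSubst g.1 polyF polyPhi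
    rw [hF, hPhi, hdet, one_pow, C_1, one_mul] at h
    rw [polyPsi, map_mul, hC]
    exact congrArg (C _ * ·) h.symm
  have hG9 : g ∈ commutant mapG9 := by
    rw [mapG9_eq, sub_eq_add_neg, ← neg_smul]
    refine commutant_inf_le_add ⟨mul_mem_commutant (hC _) ?_, mul_mem_commutant ?_ X_mem_commutant⟩
    · exact adjHessianGradient_mem_commutant hdet hF hPhi
    · rw [map_neg, map_pow, hF]
  have hG11 : g ∈ commutant mapG11 := by
    rw [mapG11_eq, sub_eq_add_neg, ← neg_smul]
    refine commutant_inf_le_add ⟨mul_mem_commutant (hC _) ?_, mul_mem_commutant ?_ X_mem_commutant⟩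
    · exact adjHessianGradient_mem_commutant hdet hPhi hF
    · rw [map_neg, map_mul, map_mul, map_ofNat, hF, hPhi]
  refine commutant_inf_le_add ⟨commutant_inf_le_add ⟨mul_mem_commutant ?_ X_mem_commutant,
    mul_mem_commutant ?_ hG9⟩, mul_mem_commutant ?_ hG11⟩ <;>
  simp only [map_add, map_mul, map_pow, hC, hF, hPhi, hPsi]

/-- Klein's quartic form in the octahedral coordinates `x`. -/
noncomputable def octForm (x : Fin 3 → ℂ) : ℂ :=
  (1 - (3 * theta - 3) / 2) * ∑ i, x i ^ 4 + (3 * theta - 3) / 2 * (∑ i, x i ^ 2) ^ 2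

theorem octForm_octahedral {A : Matrix (Fin 3) (Fin 3) ℂ} (hA : A ∈ octahedralMatrices)
    (x : Fin 3 → ℂ) : octForm (A *ᵥ x) = octForm x := by
  obtain ⟨-, σ, ε, rfl⟩ := hA
  set A : Matrix (Fin 3) (Fin 3) ℂ := Matrix.of fun i j => if σ j = i then ((ε j : ℤ) : ℂ) else 0
    with hA
  have hentry (j : Fin 3) : (A *ᵥ x) (σ j) = ((ε j : ℤ) : ℂ) * x j := by
    simp [hA, Matrix.mulVec, dotProduct]
  have hsq (j : Fin 3) : ((ε j : ℤ) : ℂ) ^ 2 = 1 := by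
    rcases Int.units_eq_one_or (ε j) with h | h <;> simp [h]
  have hfour (j : Fin 3) : ((ε j : ℤ) : ℂ) ^ 4 = 1 := by
    rw [pow_mul _ 2 2, hsq, one_pow]
  rw [octForm, octForm, ← Equiv.sum_comp σ fun i => (A *ᵥ x) i ^ 4,
    ← Equiv.sum_comp σ fun i => (A *ᵥ x) i ^ 2]
  simp only [hentry, mul_pow, hsq, hfour, one_mul]

theorem octForm_matrixQ (x : Fin 3 → ℂ) : octForm (matrixQ *ᵥ x) = octForm x := by
  have hθ := theta_sq
  simp only [octForm, matrixQ, Matrix.mulVec, dotProduct, Fin.sum_univ_three,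
    Matrix.smul_apply, smul_eq_mul, Matrix.of_apply, Matrix.cons_val]
  generalize theta = θ at *
  grind

theorem eval_polyF (v : Fin 3 → ℂ) :
    eval v polyF = (2 - 3 * theta) / 48 * octForm (matrixM *ᵥ v) := by
  have hθ := theta_sq
  have hsqrt : ((Real.sqrt 3 : ℝ) : ℂ) ^ 2 = 3 := by
    rw [← Complex.ofReal_pow, Real.sq_sqrt (by norm_num)]
    norm_num
  simp only [octForm, matrixM, Matrix.mulVec, dotProduct, Fin.sum_univ_three, Matrix.of_apply,
    Matrix.cons_val, polyF, eval_ofTerms, List.map_cons, List.map_nil, List.sum_cons, List.sum_nil]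
  generalize theta = θ at *
  generalize ((Real.sqrt 3 : ℝ) : ℂ) = s at *
  grind

theorem linearGroup_le_commutant_mapH : linearGroup ≤ commutant mapH := by
  have hle : linearGroupX ≤ (commutant mapH).comap (MulAut.conj coordChange⁻¹).toMonoidHom := by
    refine (Subgroup.closure_le _).mpr fun s hs => ?_
    have hdet : s.1.det = 1 := by
      rcases hs with hs | hs
      · exact hs.1
      · rw [hs, matrixQ_det]
    have hform (x) : octForm (s.1 *ᵥ x) = octForm x := by
      rcases hs with hs | hs
      · exact octForm_octahedral hs x
      · rw [hs, octForm_matrixQ]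
    change coordChange⁻¹ * s * (coordChange⁻¹)⁻¹ ∈ commutant mapH
    rw [inv_inv]
    refine mem_commutant_mapH ?_ (MvPolynomial.funext fun v => ?_)
    · rw [Units.val_mul, Units.val_mul, Matrix.det_mul_right_comm, Units.inv_mul, one_mul, hdet]
    · have hconj : matrixM *ᵥ ((coordChange⁻¹ * s * coordChange).1 *ᵥ v) =
          s.1 *ᵥ (matrixM *ᵥ v) := by
        change coordChange.1 *ᵥ _ = s.1 *ᵥ (coordChange.1 *ᵥ v)
        rw [Matrix.mulVec_mulVec, Matrix.mulVec_mulVec, ← Units.val_mul, ← Units.val_mul, mul_assoc,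
          mul_inv_cancel_left]
      rw [eval_linearSubst, eval_polyF, eval_polyF, hconj, hform]
  intro g hg
  simpa [Subgroup.mem_comap, mul_assoc] using hle (mem_linearGroup_iff.mp hg)

/-! ### Divisibility by a variable and restriction to a line -/

section CommRing

variable {R n : Type*} [CommRing R]

theorem eval_smul_of_isHomogeneous {p : MvPolynomial n R} {k : ℕ} (hp : p.IsHomogeneous k) (c : R)
    (v : n → R) : eval (c • v) p = c ^ k * eval v p := by
  rw [eval_eq, eval_eq, Finset.mul_sum]
  refine Finset.sum_congr rfl fun d hd => ?_
  rw [hp.degree_eq_sum_deg_support hd]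
  simp only [Pi.smul_apply, smul_eq_mul, mul_pow, Finset.prod_mul_distrib,
    Finset.prod_pow_eq_pow_sum]
  ring

/-- The substitution that replaces one variable by `q`. -/
noncomputable def updateVar [DecidableEq n] (i : n) (q : MvPolynomial n R) :
    MvPolynomial n R →ₐ[R] MvPolynomial n R :=
  aeval (Function.update X i q)

theorem eval_updateVar [DecidableEq n] (i : n) (p q : MvPolynomial n R) (v : n → R) :
    eval v (updateVar i q p) = eval (Function.update v i (eval v q)) p := by
  have h : (eval v).comp (updateVar i q).toRingHom = eval (Function.update v i (eval v q)) := by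
    ext j
    · simp
    · rcases eq_or_ne j i with rfl | hj <;> simp [updateVar, *]
  exact DFunLike.congr_fun h p

theorem X_dvd_sub_updateVar_zero [DecidableEq n] (i : n) (p : MvPolynomial n R) :
    X i ∣ p - updateVar i 0 p := by
  rw [← Ideal.mem_span_singleton, ← Ideal.Quotient.eq]
  suffices h : Ideal.Quotient.mkₐ R (Ideal.span {(X i : MvPolynomial n R)}) =
      (Ideal.Quotient.mkₐ R _).comp (updateVar i 0) from DFunLike.congr_fun h p
  ext j
  rcases eq_or_ne j i with rfl | hj
  · simp [updateVar]
  · simp [updateVar, hj]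

/-- The restriction of a polynomial to the affine line `t ↦ e + t f`. -/
noncomputable def restrictLine (e f : n → R) : MvPolynomial n R →ₐ[R] Polynomial R :=
  aeval fun i => Polynomial.C (e i) + Polynomial.C (f i) * Polynomial.X

theorem restrictLine_C (e f : n → R) (c : R) : restrictLine e f (C c) = Polynomial.C c :=
  aeval_C _ c

theorem restrictLine_X (e f : n → R) (i : n) :
    restrictLine e f (X i) = Polynomial.C (e i) + Polynomial.C (f i) * Polynomial.X :=
  aeval_X _ i

theorem eval_restrictLine (e f : n → R) (p : MvPolynomial n R) (t : R) :
    (restrictLine e f p).eval t = eval (e + t • f) p := by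
  induction p using MvPolynomial.induction_on with
  | C a => simp
  | add p q hp hq => simp only [map_add, Polynomial.eval_add, hp, hq]
  | mul_X p i hp => simp [hp, restrictLine_X, mul_comm (f i)]

/-- The derivative of a polynomial in the direction `f`. -/
noncomputable def directionalDeriv [Fintype n] (f : n → R) (p : MvPolynomial n R) :
    MvPolynomial n R :=
  ∑ i, C (f i) * pderiv i p

variable [Fintype n] {p q : MvPolynomial n R} {k : ℕ}

theorem derivative_restrictLine (e f : n → R) (p : MvPolynomial n R) :
    (restrictLine e f p).derivative = restrictLine e f (directionalDeriv f p) := by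
  have h := derivation_aeval Polynomial.derivative'
    (fun i => Polynomial.C (e i) + Polynomial.C (f i) * Polynomial.X) p
  simp only [Polynomial.derivative'_apply] at h
  rw [restrictLine, h, directionalDeriv, map_sum]
  exact Finset.sum_congr rfl fun i _ => by simpa using mul_comm _ _

theorem natCast_mul_restrictLine (e f : n → R) (hp : p.IsHomogeneous k) :
    (k : Polynomial R) * restrictLine e f p = restrictLine e f (directionalDeriv e p) +
      Polynomial.X * restrictLine e f (directionalDeriv f p) := by
  have h := congrArg (restrictLine e f) hp.sum_X_mul_pderiv
  rw [nsmul_eq_mul, map_mul, map_natCast] at h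
  rw [← h, directionalDeriv, directionalDeriv, map_sum, map_sum, map_sum, Finset.mul_sum,
    ← Finset.sum_add_distrib]
  refine Finset.sum_congr rfl fun i _ => ?_
  rw [map_mul, map_mul, map_mul, restrictLine_X, restrictLine_C, restrictLine_C]
  ring

/-- Euler's identity turns the values of the two forms into their derivatives. -/
theorem natCast_mul_wronskian_restrictLine (e f : n → R) (hp : p.IsHomogeneous k)
    (hq : q.IsHomogeneous k) :
    (k : Polynomial R) * Polynomial.wronskian (restrictLine e f p) (restrictLine e f q) =
      restrictLine e f (directionalDeriv e p * directionalDeriv f q -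
        directionalDeriv f p * directionalDeriv e q) := by
  rw [Polynomial.wronskian, derivative_restrictLine, derivative_restrictLine, map_sub, map_mul,
    map_mul]
  linear_combination restrictLine e f (directionalDeriv f q) * natCast_mul_restrictLine e f hp -
    restrictLine e f (directionalDeriv f p) * natCast_mul_restrictLine e f hq

end CommRing

section IsDomain

variable {R n : Type*} [CommRing R] [IsDomain R]

theorem X_dvd_iff_eval [Infinite R] {i : n} {p : MvPolynomial n R} :
    X i ∣ p ↔ ∀ v : n → R, v i = 0 → eval v p = 0 := by
  classical
  constructor
  · rintro ⟨q, rfl⟩ v hv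
    rw [map_mul, eval_X, hv, zero_mul]
  · intro h
    have hzero : updateVar i 0 p = 0 := MvPolynomial.funext fun v => by
      rw [eval_updateVar, map_zero]
      exact h _ (Function.update_self ..)
    simpa only [hzero, sub_zero] using X_dvd_sub_updateVar_zero i p

theorem natDegree_eq_of_wronskian_eq_zero [CharZero R] {a b : Polynomial R} (ha : a ≠ 0)
    (hb : b ≠ 0) (h : a.wronskian b = 0) : a.natDegree = b.natDegree := by
  have hlead := congrArg Polynomial.leadingCoeff (sub_eq_zero.mp h)
  rw [Polynomial.leadingCoeff_mul, Polynomial.leadingCoeff_mul, Polynomial.leadingCoeff_derivative,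
    Polynomial.leadingCoeff_derivative] at hlead
  have hne : a.leadingCoeff * b.leadingCoeff ≠ 0 := mul_ne_zero
    (Polynomial.leadingCoeff_ne_zero.mpr ha) (Polynomial.leadingCoeff_ne_zero.mpr hb)
  have hcast : (a.natDegree : R) = b.natDegree :=
    mul_left_cancel₀ hne (by linear_combination -hlead)
  exact mod_cast hcast

theorem leadingCoeff_comp_neg_X (a : Polynomial R) :
    (a.comp (-Polynomial.X)).leadingCoeff = a.leadingCoeff * (-1) ^ a.natDegree := by
  rw [Polynomial.leadingCoeff_comp (by simp), Polynomial.leadingCoeff_neg,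
    Polynomial.leadingCoeff_X]

theorem eq_zero_or_eq_zero_of_wronskian_eq_zero [CharZero R] {a b : Polynomial R}
    (ha : a.comp (-Polynomial.X) = a) (hb : b.comp (-Polynomial.X) = -b) (h : a.wronskian b = 0) :
    a = 0 ∨ b = 0 := by
  by_contra! hab
  have hdeg := natDegree_eq_of_wronskian_eq_zero hab.1 hab.2 h
  have hla := leadingCoeff_comp_neg_X a
  have hlb := leadingCoeff_comp_neg_X b
  rw [ha, eq_comm, mul_eq_left₀ (Polynomial.leadingCoeff_ne_zero.mpr hab.1)] at hla
  rw [hb, Polynomial.leadingCoeff_neg, ← hdeg, hla, mul_one, neg_eq_self] at hlb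
  exact hab.2 (Polynomial.leadingCoeff_eq_zero.mp hlb)

variable [CharZero R] [DecidableEq n] {i : n} {p : MvPolynomial n R}

theorem X_dvd_of_updateVar_neg_X (h : updateVar i (-X i) p = -p) : X i ∣ p :=
  X_dvd_iff_eval.mpr fun v hv => by
    have heval := congrArg (eval v) h
    rw [eval_updateVar, map_neg, eval_X, hv, neg_zero, map_neg, ← hv,
      Function.update_eq_self] at heval
    exact self_eq_neg.mp heval

theorem X_pow_three_dvd_of_updateVar_neg_X (h : updateVar i (-X i) p = -p) (hdvd : X i ^ 2 ∣ p) :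
    X i ^ 3 ∣ p := by
  obtain ⟨q, rfl⟩ := hdvd
  rw [pow_succ]
  refine mul_dvd_mul_left _ (X_dvd_of_updateVar_neg_X ?_)
  rw [map_mul, map_pow, updateVar, aeval_X, Function.update_self, neg_sq, ← mul_neg] at h
  exact mul_left_cancel₀ (pow_ne_zero 2 (X_ne_zero i)) h

end IsDomain

section Field

variable {K n : Type*} [Field K] [Infinite K]

theorem eval_smul_add_smul_eq_zero {e f : n → K} {p : MvPolynomial n K} {k : ℕ}
    (hp : p.IsHomogeneous k) (h : restrictLine e f p = 0) (s t : K) :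
    eval (s • e + t • f) p = 0 := by
  have hne {s : K} (hs : s ≠ 0) : eval (s • e + t • f) p = 0 := by
    have hscale : s • e + t • f = s • (e + (t / s) • f) := by
      rw [smul_add, smul_smul, mul_div_cancel₀ _ hs]
    rw [hscale, eval_smul_of_isHomogeneous hp, ← eval_restrictLine, h, Polynomial.eval_zero,
      mul_zero]
  have hline : restrictLine (t • f) e p = 0 :=
    Polynomial.eq_zero_of_infinite_isRoot _ <| (Set.finite_singleton (0 : K)).infinite_compl.mono
      fun s hs => by
        rw [Set.mem_ofPred_eq, Polynomial.IsRoot, eval_restrictLine, add_comm]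
        exact hne hs
  rw [add_comm, ← eval_restrictLine, hline, Polynomial.eval_zero]

end Field

/-! ### The reflection line `y₂ = 0` -/

theorem reflForm_dotProduct_reflCenter_eq_zero {i j : Fin 21} (h : star (root i) ⬝ᵥ root j = 0) :
    reflForm i ⬝ᵥ reflCenter j = 0 := by
  have hmap := RingHom.map_dotProduct toComplex (star (root i)) (root j)
  rw [h, map_zero] at hmap
  rw [reflForm, reflCenter, ← Matrix.dotProduct_mulVec, Matrix.mulVec_mulVec, Units.mul_inv,
    Matrix.one_mulVec, corootX, rootX, smul_dotProduct, ← hmap, smul_zero]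

theorem refl_mulVec_reflCenter {i j k : Fin 21}
    (h : twiceRefl i *ᵥ root j = (2 : ZTheta) • root k) :
    (refl i).1 *ᵥ reflCenter j = reflCenter k := by
  have hX : (reflX i).1 *ᵥ rootX j = rootX k := by
    funext l
    have hl := congrArg toComplex (congrFun h l)
    rw [RingHom.map_mulVec] at hl
    rw [coe_reflX, half, Matrix.smul_mulVec, Pi.smul_apply, rootX, hl]
    simp [rootX, map_ofNat]
  rw [refl_eq, reflCenter, Units.val_mul, Units.val_mul, Matrix.mulVec_mulVec, mul_assoc,
    Units.mul_inv, mul_one, ← Matrix.mulVec_mulVec, hX, reflCenter]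

theorem refl_mul_refl_eq {i j k : Fin 21}
    (h : twiceRefl i * twiceRefl j = (2 : ZTheta) • twiceRefl k) : refl i * refl j = refl k := by
  rw [refl_eq, refl_eq, refl_eq, ← mul_eq_of_twice (coe_reflX i) (coe_reflX j) (coe_reflX k) h]
  group

/-- Three commuting half-turns with product `1` diagonalize simultaneously. -/
theorem two_smul_eq_of_twiceRefl_mul {i j k : Fin 21}
    (h : twiceRefl i * twiceRefl j = (2 : ZTheta) • twiceRefl k)
    (hij : star (root i) ⬝ᵥ root j = 0) (v : Fin 3 → ℂ) :
    (2 : ℂ) • v = (reflForm i ⬝ᵥ v) • reflCenter i + (reflForm j ⬝ᵥ v) • reflCenter j +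
      (reflForm k ⬝ᵥ v) • reflCenter k := by
  have hv := congrArg (fun g : GL (Fin 3) ℂ => g.1 *ᵥ v) (refl_mul_refl_eq h)
  rw [Units.val_mul, ← Matrix.mulVec_mulVec, refl_mulVec, refl_mulVec, refl_mulVec,
    dotProduct_sub, dotProduct_smul, reflForm_dotProduct_reflCenter_eq_zero hij] at hv
  linear_combination (norm := module) hv

theorem two_smul_eq_reflCenter_six_one_zero (v : Fin 3 → ℂ) :
    (2 : ℂ) • v = (reflForm 6 ⬝ᵥ v) • reflCenter 6 + (reflForm 1 ⬝ᵥ v) • reflCenter 1 +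
      (reflForm 0 ⬝ᵥ v) • reflCenter 0 :=
  two_smul_eq_of_twiceRefl_mul (by decide +kernel) (by decide +kernel) v

theorem eq_zero_of_forall_reflForm_dotProduct_eq_zero {v : Fin 3 → ℂ}
    (h : ∀ i, reflForm i ⬝ᵥ v = 0) : v = 0 := by
  have hv := two_smul_eq_reflCenter_six_one_zero v
  rw [h, h, h] at hv
  simpa using hv

theorem reflCenter_zero : reflCenter 0 = Pi.single 1 (theta / Real.sqrt 3) := by
  have h3 : (Real.sqrt 3 : ℂ) ≠ 0 :=
    Complex.ofReal_ne_zero.mpr (Real.sqrt_ne_zero'.mpr (by norm_num))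
  have h : coordChange.1 *ᵥ Pi.single 1 (theta / Real.sqrt 3) = rootX 0 := by
    funext i
    fin_cases i <;> simp [coordChange, matrixM, rootX, root, toComplex_apply] <;> field_simp
  rw [reflCenter, ← h, Matrix.mulVec_mulVec, Units.inv_mul, Matrix.one_mulVec]

theorem reflForm_zero : reflForm 0 = Pi.single 1 (Real.sqrt 3 * (1 - theta)) := by
  funext i
  fin_cases i <;> simp [reflForm, corootX, root, coordChange, matrixM, toComplex_apply,
    Matrix.vecMul, dotProduct, Fin.sum_univ_three]
  ring

theorem refl_zero_mulVec (v : Fin 3 → ℂ) : (refl 0).1 *ᵥ v = -Function.update v 1 (-v 1) := by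
  have h2 := reflForm_dotProduct_reflCenter 0
  rw [reflForm_zero, reflCenter_zero, single_dotProduct, Pi.single_eq_same] at h2
  rw [refl_mulVec, reflForm_zero, reflCenter_zero, single_dotProduct]
  funext i
  fin_cases i
  · simp
  · simp only [Pi.sub_apply, Pi.smul_apply, Pi.single_eq_same, smul_eq_mul, Pi.neg_apply,
      Function.update_self, Fin.mk_one]
    linear_combination v 1 * h2
  · simp

theorem reflForm_zero_dotProduct_eq_zero {v : Fin 3 → ℂ} :
    reflForm 0 ⬝ᵥ v = 0 ↔ v 1 = 0 := by
  have h : (Real.sqrt 3 * (1 - theta) : ℂ) ≠ 0 := fun h =>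
    reflForm_ne_zero 0 (by rw [reflForm_zero, h, Pi.single_zero])
  rw [reflForm_zero, single_dotProduct, mul_eq_zero, or_iff_right h]

theorem eq_smul_reflCenter_add_smul_reflCenter {u : Fin 3 → ℂ} (hu : u 1 = 0) :
    u = ((reflForm 6 ⬝ᵥ u) / 2) • reflCenter 6 + ((reflForm 1 ⬝ᵥ u) / 2) • reflCenter 1 := by
  have h := two_smul_eq_reflCenter_six_one_zero u
  rw [reflForm_zero_dotProduct_eq_zero.mpr hu] at h
  linear_combination (norm := module) (1 / 2 : ℂ) • h

theorem reflForm_dotProduct_refl_ten_mulVec {u : Fin 3 → ℂ} (hu : u 1 = 0) :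
    reflForm 6 ⬝ᵥ ((refl 10).1 *ᵥ u) = reflForm 1 ⬝ᵥ u ∧
      reflForm 1 ⬝ᵥ ((refl 10).1 *ᵥ u) = reflForm 6 ⬝ᵥ u ∧ ((refl 10).1 *ᵥ u) 1 = 0 := by
  have hzero {i j : Fin 21} (h : star (root i) ⬝ᵥ root j = 0) :=
    reflForm_dotProduct_reflCenter_eq_zero h
  have h : (refl 10).1 *ᵥ u =
      ((reflForm 6 ⬝ᵥ u) / 2) • reflCenter 1 + ((reflForm 1 ⬝ᵥ u) / 2) • reflCenter 6 := by
    conv_lhs => rw [eq_smul_reflCenter_add_smul_reflCenter hu]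
    rw [Matrix.mulVec_add, Matrix.mulVec_smul, Matrix.mulVec_smul,
      refl_mulVec_reflCenter (k := 1) (by decide +kernel),
      refl_mulVec_reflCenter (k := 6) (by decide +kernel)]
  rw [← reflForm_zero_dotProduct_eq_zero, h]
  simp only [dotProduct_add, dotProduct_smul, reflForm_dotProduct_reflCenter, smul_eq_mul,
    hzero (i := 6) (j := 1) (by decide +kernel), hzero (i := 1) (j := 6) (by decide +kernel),
    hzero (i := 0) (j := 1) (by decide +kernel), hzero (i := 0) (j := 6) (by decide +kernel)]
  refine ⟨?_, ?_, ?_⟩ <;> ring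

/-- The Jacobian determinant of `R` along the line `y₂ = 0`. -/
noncomputable def lineJacobian (R : Fin 3 → Poly3) : Poly3 :=
  pderiv 0 (R 0) * pderiv 2 (R 2) - pderiv 2 (R 0) * pderiv 0 (R 2)

section LineJacobian

variable {R : Fin 3 → Poly3} {n : ℕ}

theorem updateVar_neg_X_of_mem_commutant (hn : Odd n) (hR : (R 1).IsHomogeneous n)
    (h : refl 0 ∈ commutant R) : updateVar 1 (-X 1) (R 1) = -R 1 :=
  MvPolynomial.funext fun v => by
    have hv := congrFun (mem_commutant.mp h v) 1
    rw [refl_zero_mulVec, refl_zero_mulVec, Pi.neg_apply, Function.update_self, neg_neg, evalMap,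
      evalMap, ← neg_one_smul ℂ, eval_smul_of_isHomogeneous hR, hn.neg_one_pow] at hv
    rw [eval_updateVar, map_neg, eval_X, map_neg, ← hv, neg_one_mul, neg_neg]

theorem wronskian_restrictLine_eq_zero (hn : n ≠ 0) (hR : ∀ i, (R i).IsHomogeneous n)
    (hJ : X 1 ∣ lineJacobian R) {e f : Fin 3 → ℂ} (he : e 1 = 0) (hf : f 1 = 0) :
    (restrictLine e f (R 0)).wronskian (restrictLine e f (R 2)) = 0 := by
  have hX : restrictLine e f (X 1) = 0 := by
    rw [restrictLine_X, he, hf, map_zero, zero_mul, add_zero]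
  have hline : restrictLine e f (lineJacobian R) = 0 := by
    obtain ⟨q, hq⟩ := hJ
    rw [hq, map_mul, hX, zero_mul]
  have hdir : directionalDeriv e (R 0) * directionalDeriv f (R 2) -
      directionalDeriv f (R 0) * directionalDeriv e (R 2) =
        C (e 0 * f 2 - e 2 * f 0) * lineJacobian R := by
    simp only [directionalDeriv, Fin.sum_univ_three, he, hf, lineJacobian, map_sub, map_mul,
      map_zero]
    ring
  have h := natCast_mul_wronskian_restrictLine e f (hR 0) (hR 2)
  rw [hdir, map_mul, hline, mul_zero] at h
  exact (mul_eq_zero.mp h).resolve_left (Nat.cast_ne_zero.mpr hn)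

/-- The value of `a` on the restriction of `R` to the line `t ↦ e + t f`. -/
noncomputable def restrictForm (R : Fin 3 → Poly3) (e f a : Fin 3 → ℂ) : Polynomial ℂ :=
  restrictLine e f (∑ i, C (a i) * R i)

theorem eval_restrictForm (e f a : Fin 3 → ℂ) (t : ℂ) :
    (restrictForm R e f a).eval t = a ⬝ᵥ evalMap R (e + t • f) := by
  rw [restrictForm, eval_restrictLine]
  simp only [map_sum, map_mul, eval_C, dotProduct, evalMap]

theorem wronskian_restrictForm_eq_zero (hn : n ≠ 0) (hR : ∀ i, (R i).IsHomogeneous n)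
    (hJ : X 1 ∣ lineJacobian R) (h1 : X 1 ∣ R 1) {e f : Fin 3 → ℂ} (he : e 1 = 0) (hf : f 1 = 0)
    (a b : Fin 3 → ℂ) : (restrictForm R e f a).wronskian (restrictForm R e f b) = 0 := by
  have hzero : restrictLine e f (R 1) = 0 := by
    obtain ⟨q, hq⟩ := h1
    rw [hq, map_mul, restrictLine_X, he, hf, map_zero, zero_mul, add_zero, zero_mul]
  have hform (a : Fin 3 → ℂ) : restrictForm R e f a =
      Polynomial.C (a 0) * restrictLine e f (R 0) +
        Polynomial.C (a 2) * restrictLine e f (R 2) := by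
    rw [restrictForm, Fin.sum_univ_three]
    simp only [map_add, map_mul, restrictLine_C, hzero, mul_zero, add_zero]
  have hw := wronskian_restrictLine_eq_zero hn hR hJ he hf
  rw [Polynomial.wronskian] at hw
  rw [hform, hform, Polynomial.wronskian]
  simp only [Polynomial.derivative_add, Polynomial.derivative_C_mul]
  linear_combination (Polynomial.C (a 0) * Polynomial.C (b 2) -
    Polynomial.C (a 2) * Polynomial.C (b 0)) * hw

theorem dotProduct_evalMap_eq_zero (hR : ∀ i, (R i).IsHomogeneous n) {e f a : Fin 3 → ℂ}
    (h : restrictForm R e f a = 0) (s t : ℂ) : a ⬝ᵥ evalMap R (s • e + t • f) = 0 := by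
  have hform : (∑ i, C (a i) * R i).IsHomogeneous n :=
    IsHomogeneous.sum _ _ _ fun i _ => (hR i).C_mul (a i)
  simpa [dotProduct, evalMap] using eval_smul_add_smul_eq_zero hform h s t

variable (hR : ∀ i, (R i).IsHomogeneous n) (hG : linearGroup ≤ commutant R)

include hR hG

theorem restrictForm_eq_zero_or_eq_zero (hn : n ≠ 0) (hJ : X 1 ∣ lineJacobian R) (h1 : X 1 ∣ R 1) :
    restrictForm R (reflCenter 6) (reflCenter 1) (reflForm 6) = 0 ∨
      restrictForm R (reflCenter 6) (reflCenter 1) (reflForm 1) = 0 := by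
  have h01 : reflForm 0 ⬝ᵥ reflCenter 1 = 0 :=
    reflForm_dotProduct_reflCenter_eq_zero (by decide +kernel)
  have h06 : reflForm 0 ⬝ᵥ reflCenter 6 = 0 :=
    reflForm_dotProduct_reflCenter_eq_zero (by decide +kernel)
  have h16 : reflForm 1 ⬝ᵥ reflCenter 6 = 0 :=
    reflForm_dotProduct_reflCenter_eq_zero (by decide +kernel)
  have h61 : reflForm 6 ⬝ᵥ reflCenter 1 = 0 :=
    reflForm_dotProduct_reflCenter_eq_zero (by decide +kernel)
  have hrefl (t : ℂ) : (refl 6).1 *ᵥ (reflCenter 6 + t • reflCenter 1) =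
      reflCenter 6 + (-t) • reflCenter 1 := by
    rw [refl_mulVec, dotProduct_add, dotProduct_smul, h61, reflForm_dotProduct_reflCenter]
    module
  have hR6 (t : ℂ) := mem_commutant.mp (hG (refl_mem_linearGroup 6))
    (reflCenter 6 + t • reflCenter 1)
  refine eq_zero_or_eq_zero_of_wronskian_eq_zero ?_ ?_ (wronskian_restrictForm_eq_zero hn hR hJ h1
    (reflForm_zero_dotProduct_eq_zero.mp h06) (reflForm_zero_dotProduct_eq_zero.mp h01) _ _)
  · refine Polynomial.funext fun t => ?_
    rw [Polynomial.eval_comp, Polynomial.eval_neg, Polynomial.eval_X, eval_restrictForm,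
      eval_restrictForm, ← hrefl, hR6, refl_mulVec, dotProduct_sub, dotProduct_smul,
      reflForm_dotProduct_reflCenter, smul_eq_mul]
    ring
  · refine Polynomial.funext fun t => ?_
    rw [Polynomial.eval_comp, Polynomial.eval_neg, Polynomial.eval_X, Polynomial.eval_neg,
      eval_restrictForm, eval_restrictForm, ← hrefl, hR6, refl_mulVec, dotProduct_sub,
      dotProduct_smul, h16, smul_zero, zero_sub]

theorem X_dvd_of_X_dvd_lineJacobian (hn : n ≠ 0) (hJ : X 1 ∣ lineJacobian R) (h1 : X 1 ∣ R 1)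
    (i : Fin 3) : X 1 ∣ R i := by
  have hR1 {w : Fin 3 → ℂ} (hw : w 1 = 0) : evalMap R w 1 = 0 := X_dvd_iff_eval.mp h1 w hw
  have hvalue {w : Fin 3 → ℂ} (hw : w 1 = 0) :
      reflForm 6 ⬝ᵥ evalMap R w = 0 ∧ reflForm 1 ⬝ᵥ evalMap R w = 0 := by
    have hg := mem_commutant.mp (hG (refl_mem_linearGroup 10))
    have hswap := reflForm_dotProduct_refl_ten_mulVec (hR1 hw)
    have hgw := (reflForm_dotProduct_refl_ten_mulVec hw).2.2
    rw [← hg] at hswap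
    rcases restrictForm_eq_zero_or_eq_zero hR hG hn hJ h1 with h | h
    · have hall {u : Fin 3 → ℂ} (hu : u 1 = 0) : reflForm 6 ⬝ᵥ evalMap R u = 0 := by
        rw [eq_smul_reflCenter_add_smul_reflCenter hu]
        exact dotProduct_evalMap_eq_zero hR h _ _
      exact ⟨hall hw, hswap.1.symm.trans (hall hgw)⟩
    · have hall {u : Fin 3 → ℂ} (hu : u 1 = 0) : reflForm 1 ⬝ᵥ evalMap R u = 0 := by
        rw [eq_smul_reflCenter_add_smul_reflCenter hu]
        exact dotProduct_evalMap_eq_zero hR h _ _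
      exact ⟨hswap.2.1.symm.trans (hall hgw), hall hw⟩
  refine X_dvd_iff_eval.mpr fun w hw => ?_
  have hzero := eq_smul_reflCenter_add_smul_reflCenter (hR1 hw)
  rw [(hvalue hw).1, (hvalue hw).2, zero_div, zero_smul, zero_smul, add_zero] at hzero
  exact congrFun hzero i

end LineJacobian

/-! ### The product of the reflection forms and the Jacobian determinant -/

section General

variable {R n : Type*} [CommRing R]

theorem isHomogeneous_det [Fintype n] [DecidableEq n] {m : Type*} {d : ℕ}
    {A : Matrix n n (MvPolynomial m R)} (h : ∀ i j, (A i j).IsHomogeneous d) :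
    A.det.IsHomogeneous (Fintype.card n * d) := by
  rw [Matrix.det_apply]
  refine IsHomogeneous.sum _ _ _ fun σ _ => ?_
  have hprod := IsHomogeneous.prod Finset.univ (fun i => A (σ i) i) (fun _ => d)
    fun i _ => h (σ i) i
  rw [Finset.sum_const, Finset.card_univ, smul_eq_mul] at hprod
  rcases Int.units_eq_one_or (Equiv.Perm.sign σ) with hσ | hσ <;> rw [hσ]
  · simpa using hprod
  · simpa using hprod.neg

/-- An invertible linear substitution, as an automorphism of the polynomial ring. -/
noncomputable def linearSubstEquiv [Fintype n] [DecidableEq n] (g : GL n R) :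
    MvPolynomial n R ≃ₐ[R] MvPolynomial n R :=
  AlgEquiv.ofAlgHom (linearSubst g.1) (linearSubst (g⁻¹).1)
    (AlgHom.ext fun p => by
      rw [AlgHom.comp_apply, linearSubst_linearSubst, Units.inv_mul, linearSubst_one,
        AlgHom.id_apply])
    (AlgHom.ext fun p => by
      rw [AlgHom.comp_apply, linearSubst_linearSubst, Units.mul_inv, linearSubst_one,
        AlgHom.id_apply])

theorem eq_C_mul_of_dvd_of_isHomogeneous [IsDomain R] {p q : MvPolynomial n R} {k : ℕ}
    (hp : p.IsHomogeneous k) (hq : q.IsHomogeneous k) (h : q ∣ p) : ∃ c : R, p = C c * q := by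
  rcases eq_or_ne p 0 with rfl | hp0
  · exact ⟨0, by rw [C_0, zero_mul]⟩
  obtain ⟨r, rfl⟩ := h
  have hdeg := totalDegree_mul_of_isDomain (left_ne_zero_of_mul hp0) (right_ne_zero_of_mul hp0)
  rw [hp.totalDegree hp0, hq.totalDegree (left_ne_zero_of_mul hp0)] at hdeg
  have hr : r = C (r.coeff 0) := totalDegree_eq_zero_iff_eq_C.mp (by lia)
  exact ⟨_, by rw [← hr, mul_comm]⟩

end General

theorem isHomogeneous_jacobianDet {R : Fin 3 → Poly3} {n : ℕ} (hR : ∀ i, (R i).IsHomogeneous n) :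
    (jacobianDet R).IsHomogeneous (3 * (n - 1)) :=
  isHomogeneous_det (A := jacobian R) fun i _ => (hR i).pderiv

theorem linearForm_single (i : Fin 3) (c : ℂ) : linearForm (Pi.single i c) = C c * X i :=
  MvPolynomial.funext fun v => by
    rw [eval_linearForm, single_dotProduct, map_mul, eval_C, eval_X]

theorem isUnit_C {s : ℂ} (hs : s ≠ 0) : IsUnit (C s : Poly3) := (IsUnit.mk0 s hs).map C

theorem exists_linearSubst_linearForm (i : Fin 21) : ∃ k ∈ linearGroup, ∃ s : ℂ, s ≠ 0 ∧
    linearSubst k.1 (linearForm (reflForm i)) = C s * X 1 := by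
  obtain ⟨k, hk, s, hs, -, hform⟩ := exists_mem_linearGroup_mul_refl_eq i
  have hform' : reflForm i ᵥ* k.1 = Pi.single 1 (s * (Real.sqrt 3 * (1 - theta))) := by
    rw [hform, reflForm_zero, ← Pi.single_smul, smul_eq_mul]
  refine ⟨k, hk, _, fun h => ?_, by rw [linearSubst_linearForm, hform', linearForm_single]⟩
  rw [hform, h, Pi.single_zero] at hform'
  exact (smul_ne_zero hs (reflForm_ne_zero 0)) hform'

theorem pow_linearForm_dvd_iff {i : Fin 21} {k : GL (Fin 3) ℂ} {s : ℂ} (hs : s ≠ 0)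
    (hk : linearSubst k.1 (linearForm (reflForm i)) = C s * X 1) (n : ℕ) (p : Poly3) :
    linearForm (reflForm i) ^ n ∣ p ↔ X 1 ^ n ∣ linearSubst k.1 p := by
  rw [← map_dvd_iff (linearSubstEquiv k)]
  change linearSubst k.1 (linearForm (reflForm i) ^ n) ∣ linearSubst k.1 p ↔ _
  rw [map_pow, hk, mul_pow]
  exact ((isUnit_C hs).pow n).mul_left_dvd

theorem prime_linearForm (i : Fin 21) : Prime (linearForm (reflForm i)) := by
  obtain ⟨k, -, s, hs, hk⟩ := exists_linearSubst_linearForm i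
  rw [← MulEquiv.prime_iff (linearSubstEquiv k).toMulEquiv]
  change Prime (linearSubst k.1 (linearForm (reflForm i)))
  rw [hk]
  exact (associated_unit_mul_left (X 1) _ (isUnit_C hs)).symm.prime (X_prime)

theorem not_linearForm_dvd {i j : Fin 21} (hij : i ≠ j) :
    ¬ linearForm (reflForm i) ∣ linearForm (reflForm j) := by
  rintro ⟨q, hq⟩
  have hker (v : Fin 3 → ℂ) (hv : reflForm i ⬝ᵥ v = 0) : reflForm j ⬝ᵥ v = 0 := by
    rw [← eval_linearForm, hq, map_mul, eval_linearForm, hv, zero_mul]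
  obtain ⟨s, hs⟩ := exists_eq_smul_of_forall_dotProduct_eq_zero hker
  exact reflForm_ne_smul_reflForm hij.symm s hs

/-- The product of the linear forms of the reflection lines. -/
noncomputable def lineProduct : Poly3 := ∏ i, linearForm (reflForm i)

theorem lineProduct_ne_zero : lineProduct ≠ 0 :=
  Finset.prod_ne_zero_iff.mpr fun i _ => (prime_linearForm i).ne_zero

theorem isHomogeneous_lineProduct : lineProduct.IsHomogeneous 21 := by
  simpa [lineProduct] using IsHomogeneous.prod Finset.univ (fun i => linearForm (reflForm i))
    (fun _ => 1) fun i _ => isHomogeneous_linearForm (reflForm i)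

theorem lineProduct_pow_dvd {p : Poly3} {n : ℕ} (h : ∀ i, linearForm (reflForm i) ^ n ∣ p) :
    lineProduct ^ n ∣ p := by
  rw [lineProduct, ← Finset.prod_pow]
  refine Finset.prod_dvd_of_isRelPrime (fun i _ j _ hij => IsRelPrime.pow ?_) fun i _ => h i
  exact (prime_linearForm i).irreducible.isRelPrime_iff_not_dvd.mpr (not_linearForm_dvd hij)

theorem lineProduct_pow_dvd_of_X_pow_dvd {p : Poly3} {n : ℕ}
    (hp : ∀ g ∈ linearGroup, linearSubst g.1 p = p) (h : X 1 ^ n ∣ p) : lineProduct ^ n ∣ p :=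
  lineProduct_pow_dvd fun i => by
    obtain ⟨k, hk, s, hs, hform⟩ := exists_linearSubst_linearForm i
    rwa [pow_linearForm_dvd_iff hs hform, hp k hk]

theorem lineProduct_dvd_of_X_dvd {R : Fin 3 → Poly3} (hG : linearGroup ≤ commutant R)
    (h : ∀ j, X 1 ∣ R j) (j : Fin 3) : lineProduct ∣ R j := by
  rw [← pow_one lineProduct]
  refine lineProduct_pow_dvd fun i => ?_
  obtain ⟨k, hk, s, hs, hform⟩ := exists_linearSubst_linearForm i
  rw [pow_linearForm_dvd_iff hs hform, pow_one, linearSubst_of_mem_commutant (hG hk),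
    Matrix.mulVec, dotProduct]
  exact Finset.dvd_sum fun l _ => (h l).mul_left _

section Jacobian

variable {R : Fin 3 → Poly3}

theorem exists_jacobianDet_eq_of_eq_X_pow_mul {m : ℕ} {u : Poly3} (h : R 1 = X 1 ^ (m + 1) * u) :
    ∃ w, jacobianDet R = X 1 ^ m * (C (m + 1 : ℂ) * u * lineJacobian R + X 1 * w) := by
  have hd0 : pderiv 0 (R 1) = X 1 ^ (m + 1) * pderiv 0 u := by
    rw [h, pderiv_mul, pderiv_pow, pderiv_X_of_ne (by decide)]
    ring
  have hd2 : pderiv 2 (R 1) = X 1 ^ (m + 1) * pderiv 2 u := by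
    rw [h, pderiv_mul, pderiv_pow, pderiv_X_of_ne (by decide)]
    ring
  have hd1 : pderiv 1 (R 1) = X 1 ^ m * (C (m + 1 : ℂ) * u) + X 1 ^ (m + 1) * pderiv 1 u := by
    rw [h, pderiv_mul, pderiv_pow, pderiv_X_self, map_add, map_natCast, map_one, Nat.cast_add,
      Nat.cast_one, Nat.add_sub_cancel]
    ring
  refine ⟨pderiv 1 u * lineJacobian R -
    pderiv 0 u * (pderiv 1 (R 0) * pderiv 2 (R 2) - pderiv 2 (R 0) * pderiv 1 (R 2)) -
    pderiv 2 u * (pderiv 0 (R 0) * pderiv 1 (R 2) - pderiv 1 (R 0) * pderiv 0 (R 2)), ?_⟩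
  rw [jacobianDet, Matrix.det_fin_three, lineJacobian]
  simp only [Matrix.of_apply, hd0, hd1, hd2]
  ring

theorem X_pow_dvd_jacobianDet {m : ℕ} (h : X 1 ^ (m + 1) ∣ R 1) : X 1 ^ m ∣ jacobianDet R := by
  obtain ⟨u, hu⟩ := h
  obtain ⟨w, hw⟩ := exists_jacobianDet_eq_of_eq_X_pow_mul hu
  exact ⟨_, hw⟩

theorem X_pow_succ_dvd_of_X_pow_dvd_jacobianDet (hL : ¬ X 1 ∣ lineJacobian R) (h1 : X 1 ∣ R 1)
    {m : ℕ} (h : X 1 ^ m ∣ jacobianDet R) : X 1 ^ (m + 1) ∣ R 1 := by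
  induction m with
  | zero => simpa using h1
  | succ m ih =>
    obtain ⟨u, hu⟩ := ih ((pow_dvd_pow _ m.le_succ).trans h)
    obtain ⟨w, hw⟩ := exists_jacobianDet_eq_of_eq_X_pow_mul hu
    rw [hw, pow_succ, mul_dvd_mul_iff_left (pow_ne_zero m (X_ne_zero 1)),
      dvd_add_left (dvd_mul_right ..), mul_assoc,
      (isUnit_C (Nat.cast_add_one_ne_zero m)).dvd_mul_left] at h
    rw [hu, pow_succ _ (m + 1)]
    exact mul_dvd_mul_left _ ((X_prime.dvd_or_dvd h).resolve_right hL)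

variable {n : ℕ} (hG : linearGroup ≤ commutant R)

include hG

theorem lineProduct_pow_dvd_jacobianDet {m : ℕ} (h : X 1 ^ m ∣ jacobianDet R) :
    lineProduct ^ m ∣ jacobianDet R :=
  lineProduct_pow_dvd_of_X_pow_dvd (fun _ hg => linearSubst_det_jacobian (hG hg)) h

theorem eq_zero_of_apply_one_eq_zero (h1 : R 1 = 0) : R = 0 := by
  funext j
  refine MvPolynomial.funext fun v => ?_
  suffices h : evalMap R v = 0 from congrFun h j
  refine eq_zero_of_forall_reflForm_dotProduct_eq_zero fun i => ?_
  obtain ⟨k, hk, s, -, -, hform⟩ := exists_mem_linearGroup_mul_refl_eq i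
  have hv := mem_commutant.mp (hG hk) ((k⁻¹).1 *ᵥ v)
  rw [Matrix.mulVec_mulVec, Units.mul_inv, Matrix.one_mulVec] at hv
  rw [hv, Matrix.dotProduct_mulVec, hform, reflForm_zero, smul_dotProduct, single_dotProduct,
    evalMap, h1, map_zero, mul_zero, smul_zero]

variable (hn : Odd n) (hR : ∀ i, (R i).IsHomogeneous n)

include hn hR

theorem X_dvd_apply_one : X 1 ∣ R 1 :=
  X_dvd_of_updateVar_neg_X
    (updateVar_neg_X_of_mem_commutant hn (hR 1) (hG (refl_mem_linearGroup 0)))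

theorem eq_zero_of_X_dvd_lineJacobian (hn21 : n < 21) (hL : X 1 ∣ lineJacobian R) : R = 0 := by
  funext i
  by_contra hi
  have hdvd := lineProduct_dvd_of_X_dvd hG
    (X_dvd_of_X_dvd_lineJacobian hR hG hn.pos.ne' hL (X_dvd_apply_one hG hn hR)) i
  have hdeg := totalDegree_le_of_dvd_of_isDomain hdvd hi
  rw [(hR i).totalDegree hi, isHomogeneous_lineProduct.totalDegree lineProduct_ne_zero] at hdeg
  lia

theorem X_pow_succ_dvd_apply_one (hn21 : n < 21) {m : ℕ} (h : X 1 ^ m ∣ jacobianDet R) :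
    X 1 ^ (m + 1) ∣ R 1 := by
  by_cases hL : X 1 ∣ lineJacobian R
  · rw [eq_zero_of_X_dvd_lineJacobian hG hn hR hn21 hL]
    exact dvd_zero _
  · exact X_pow_succ_dvd_of_X_pow_dvd_jacobianDet hL (X_dvd_apply_one hG hn hR) h

theorem eq_zero_of_jacobianDet_eq_zero (hn21 : n < 21) (hJ : jacobianDet R = 0) : R = 0 := by
  refine eq_zero_of_apply_one_eq_zero hG ?_
  by_contra h1
  refine FiniteMultiplicity.not_iff_forall.mpr (fun m => ?_)
    (FiniteMultiplicity.of_prime_left (X_prime (i := (1 : Fin 3))) h1)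
  exact (pow_dvd_pow _ m.le_succ).trans
    (X_pow_succ_dvd_apply_one hG hn hR hn21 (hJ ▸ dvd_zero _))

end Jacobian

/-! ### The map `h` on a reflection line -/

theorem X_sq_dvd_of_eval_pderiv {R n : Type*} [CommRing R] [IsDomain R] [Infinite R] {i : n}
    {p : MvPolynomial n R} (hdvd : X i ∣ p) (h : ∀ v, v i = 0 → eval v (pderiv i p) = 0) :
    X i ^ 2 ∣ p := by
  obtain ⟨q, rfl⟩ := hdvd
  rw [sq]
  refine mul_dvd_mul_left _ (X_dvd_iff_eval.mpr fun v hv => ?_)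
  simpa [pderiv_mul, hv] using h v hv

theorem mulVec_eq_zero_iff {R n : Type*} [CommRing R] [Fintype n] [DecidableEq n] (g : GL n R)
    {v : n → R} : g.1 *ᵥ v = 0 ↔ v = 0 := by
  refine ⟨fun h => ?_, fun h => by rw [h, Matrix.mulVec_zero]⟩
  rw [← Matrix.one_mulVec v, ← Units.inv_mul g, ← Matrix.mulVec_mulVec, h, Matrix.mulVec_zero]

/-- By Euler's identity the common zero lies in the kernel of the Jacobian matrix. -/
theorem eval_det_jacobian_eq_zero {R n : Type*} [CommRing R] [IsDomain R] [Fintype n]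
    [DecidableEq n] {P : n → MvPolynomial n R} {k : ℕ} (hP : ∀ i, (P i).IsHomogeneous k)
    {v : n → R} (hv : v ≠ 0) (h : evalMap P v = 0) : eval v (jacobian P).det = 0 := by
  rw [RingHom.map_det]
  refine Matrix.exists_mulVec_eq_zero_iff.mp ⟨v, hv, funext fun i => ?_⟩
  have heuler := congrArg (eval v) (hP i).sum_X_mul_pderiv
  have hvi : eval v (P i) = 0 := congrFun h i
  rw [map_nsmul, hvi, smul_zero, map_sum] at heuler
  simpa [jacobian, Matrix.mulVec, dotProduct, mul_comm] using heuler

theorem eval_mapH_zero {v : Fin 3 → ℂ} (hv : v 1 = 0) : eval v (mapH 0) =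
    v 0 ^ 4 * (22032 * v 0 ^ 11 + 113400 * v 0 ^ 10 * v 2 + 45360 * v 0 ^ 9 * v 2 ^ 2 +
      2619540 * v 0 ^ 8 * v 2 ^ 3 - 8989785 * v 0 ^ 7 * v 2 ^ 4 - 25671492 * v 0 ^ 6 * v 2 ^ 5 -
      73347120 * v 0 ^ 5 * v 2 ^ 6 + 64178730 * v 0 ^ 4 * v 2 ^ 7 - 32089365 * v 0 ^ 3 * v 2 ^ 8 +
      299500740 * v 0 ^ 2 * v 2 ^ 9 + 209650518 * v 0 * v 2 ^ 10 - 1048252590 * v 2 ^ 11) := by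
  simp only [mapH, polyPsi_eq, gradient, dotProduct, Fin.sum_univ_three, polyPhi_eq, polyF, mapG9,
    mapG11, pderiv_ofTerms, map_mul, map_add, map_pow, eval_C, eval_X, eval_ofTerms, derivTerm,
    List.map_cons, List.map_nil, List.sum_cons, List.sum_nil, Matrix.cons_val, hv]
  push_cast
  ring

theorem eval_mapH_two {v : Fin 3 → ℂ} (hv : v 1 = 0) : eval v (mapH 2) =
    -704 * v 0 ^ 15 + 36960 * v 0 ^ 14 * v 2 + 221760 * v 0 ^ 13 * v 2 ^ 2 +
      560560 * v 0 ^ 12 * v 2 ^ 3 + 2651880 * v 0 ^ 11 * v 2 ^ 4 - 7844067 * v 0 ^ 10 * v 2 ^ 5 -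
      23185085 * v 0 ^ 9 * v 2 ^ 6 - 68083785 * v 0 ^ 8 * v 2 ^ 7 + 121226490 * v 0 ^ 7 * v 2 ^ 8 -
      187914265 * v 0 ^ 6 * v 2 ^ 9 + 202440315 * v 0 ^ 5 * v 2 ^ 10 +
      150506685 * v 0 ^ 4 * v 2 ^ 11 - 767071480 * v 0 ^ 3 * v 2 ^ 12 -
      141178800 * v 0 ^ 2 * v 2 ^ 13 + 105413504 * v 2 ^ 15 := by
  simp only [mapH, polyPsi_eq, gradient, dotProduct, Fin.sum_univ_three, polyPhi_eq, polyF, mapG9,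
    mapG11, pderiv_ofTerms, map_mul, map_add, map_pow, eval_C, eval_X, eval_ofTerms, derivTerm,
    List.map_cons, List.map_nil, List.sum_cons, List.sum_nil, Matrix.cons_val, hv]
  push_cast
  ring

theorem X_sq_dvd_mapH_one : X 1 ^ 2 ∣ mapH 1 := by
  refine X_sq_dvd_of_eval_pderiv (X_dvd_apply_one linearGroup_le_commutant_mapH (by decide)
    isHomogeneous_mapH) fun v hv => ?_
  simp only [mapH, map_add, pderiv_mul, pderiv_X_self, map_mul, eval_X, hv, mul_zero, zero_add,
    mul_one]
  simp only [polyPsi_eq, gradient, dotProduct, Fin.sum_univ_three, polyPhi_eq, polyF, mapG9,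
    mapG11, pderiv_ofTerms, pderiv_C, map_zero, map_mul, map_add, map_pow, eval_C, eval_ofTerms,
    derivTerm, List.map_cons, List.map_nil, List.sum_cons, List.sum_nil, Matrix.cons_val, hv]
  push_cast
  ring

theorem X_pow_three_dvd_mapH_one : X 1 ^ 3 ∣ mapH 1 :=
  X_pow_three_dvd_of_updateVar_neg_X
    (updateVar_neg_X_of_mem_commutant (by decide) (isHomogeneous_mapH 1)
      (linearGroup_le_commutant_mapH (refl_mem_linearGroup 0))) X_sq_dvd_mapH_one

theorem eq_zero_of_binary_forms_eq_zero {x z : ℂ}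
    (hA :
      x ^ 4 * (22032 * x ^ 11 + 113400 * x ^ 10 * z + 45360 * x ^ 9 * z ^ 2 +
        2619540 * x ^ 8 * z ^ 3 - 8989785 * x ^ 7 * z ^ 4 - 25671492 * x ^ 6 * z ^ 5 -
        73347120 * x ^ 5 * z ^ 6 + 64178730 * x ^ 4 * z ^ 7 - 32089365 * x ^ 3 * z ^ 8 +
        299500740 * x ^ 2 * z ^ 9 + 209650518 * x * z ^ 10 - 1048252590 * z ^ 11) = 0)
    (hB :
      -704 * x ^ 15 + 36960 * x ^ 14 * z + 221760 * x ^ 13 * z ^ 2 + 560560 * x ^ 12 * z ^ 3 +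
        2651880 * x ^ 11 * z ^ 4 - 7844067 * x ^ 10 * z ^ 5 - 23185085 * x ^ 9 * z ^ 6 -
        68083785 * x ^ 8 * z ^ 7 + 121226490 * x ^ 7 * z ^ 8 - 187914265 * x ^ 6 * z ^ 9 +
        202440315 * x ^ 5 * z ^ 10 + 150506685 * x ^ 4 * z ^ 11 - 767071480 * x ^ 3 * z ^ 12 -
        141178800 * x ^ 2 * z ^ 13 + 105413504 * z ^ 15 = 0) :
    x = 0 ∧ z = 0 := by
  rcases mul_eq_zero.mp hA with h | h
  · have hx : x = 0 := pow_eq_zero_iff (by norm_num) |>.mp h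
    rw [hx] at hB
    refine ⟨hx, pow_eq_zero_iff (n := 15) (by norm_num) |>.mp ?_⟩
    linear_combination (1 / 105413504 : ℂ) * hB
  · -- The two factors are coprime: their Bézout cofactors give a multiple of `z ^ 25`.
    have hz : z = 0 := by
      refine pow_eq_zero_iff (n := 25) (by norm_num) |>.mp ?_
      linear_combination (1 / 14266723535563307584699478016 : ℂ) *
        ((-3287894945984 * x ^ 14 + 161643507109920 * x ^ 13 * z + 1601027596155680 * x ^ 12 * z ^ 2
          + 6610144564192400 * x ^ 11 * z ^ 3 + 25606095327424920 * x ^ 10 * z ^ 4 +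
          21308641210752973 * x ^ 9 * z ^ 5 - 163293263846224050 * x ^ 8 * z ^ 6 -
          683469741343695075 * x ^ 7 * z ^ 7 - 973036431838636935 * x ^ 6 * z ^ 8 -
          862951437597927370 * x ^ 5 * z ^ 9 - 3579627683318998311 * x ^ 4 * z ^ 10 +
          1203940459933519000 * x ^ 3 * z ^ 11 - 3937083765393805040 * x ^ 2 * z ^ 12 -
          2601001125542225280 * x * z ^ 13 - 13941941017017032320 * z ^ 14) * h +
        (-102896166832272 * x ^ 10 - 872954352769320 * x ^ 9 * z - 2311892109462600 * x ^ 8 * z ^ 2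
          - 15344820053006220 * x ^ 7 * z ^ 3 - 3814947960942195 * x ^ 6 * z ^ 4 +
          213909372686656647 * x ^ 5 * z ^ 5 + 788481023815058805 * x ^ 4 * z ^ 6 +
          1424482549162211385 * x ^ 3 * z ^ 7 + 1212910630640838360 * x ^ 2 * z ^ 8 +
          1863413910427594140 * x * z ^ 9 - 3300831790507889946 * z ^ 10) * hB)
    rw [hz] at hB
    refine ⟨pow_eq_zero_iff (n := 15) (by norm_num) |>.mp ?_, hz⟩
    linear_combination (1 / (-704) : ℂ) * hB

theorem eq_zero_of_evalMap_mapH_of_apply_one {v : Fin 3 → ℂ} (hv : v 1 = 0)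
    (h : evalMap mapH v = 0) : v = 0 := by
  have h0 : eval v (mapH 0) = 0 := congrFun h 0
  have h2 : eval v (mapH 2) = 0 := congrFun h 2
  rw [eval_mapH_zero hv] at h0
  rw [eval_mapH_two hv] at h2
  obtain ⟨hx, hz⟩ := eq_zero_of_binary_forms_eq_zero h0 h2
  funext j
  fin_cases j
  exacts [hx, hv, hz]

theorem jacobianDet_mapH : ∃ c : ℂ, c ≠ 0 ∧ jacobianDet mapH = C c * lineProduct ^ 2 := by
  obtain ⟨c, hc⟩ := eq_C_mul_of_dvd_of_isHomogeneous
    (isHomogeneous_jacobianDet isHomogeneous_mapH) (isHomogeneous_lineProduct.pow 2)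
    (lineProduct_pow_dvd_jacobianDet linearGroup_le_commutant_mapH
      (X_pow_dvd_jacobianDet X_pow_three_dvd_mapH_one))
  refine ⟨c, ?_, hc⟩
  rintro rfl
  rw [C_0, zero_mul] at hc
  have hzero := eq_zero_of_jacobianDet_eq_zero linearGroup_le_commutant_mapH (by decide)
    isHomogeneous_mapH (by decide) hc
  have hsingle : (Pi.single 0 1 : Fin 3 → ℂ) = 0 :=
    eq_zero_of_evalMap_mapH_of_apply_one (by simp) (by funext j; simp [evalMap, hzero])
  exact one_ne_zero (Pi.single_eq_zero_iff.mp hsingle)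

theorem eval_lineProduct_eq_zero_iff {v : Fin 3 → ℂ} :
    eval v lineProduct = 0 ↔ ∃ i, reflForm i ⬝ᵥ v = 0 := by
  simp [lineProduct, Finset.prod_eq_zero_iff, eval_linearForm]

theorem eq_zero_of_evalMap_mapH_of_reflForm {i : Fin 21} {v : Fin 3 → ℂ}
    (hv : reflForm i ⬝ᵥ v = 0) (h : evalMap mapH v = 0) : v = 0 := by
  obtain ⟨k, hk, s, hs, -, hform⟩ := exists_mem_linearGroup_mul_refl_eq i
  obtain ⟨w, rfl⟩ : ∃ w, k.1 *ᵥ w = v :=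
    ⟨(k⁻¹).1 *ᵥ v, by rw [Matrix.mulVec_mulVec, Units.mul_inv, Matrix.one_mulVec]⟩
  rw [Matrix.dotProduct_mulVec, hform, smul_dotProduct, smul_eq_zero_iff_right hs,
    reflForm_zero_dotProduct_eq_zero] at hv
  rw [mem_commutant.mp (linearGroup_le_commutant_mapH hk), mulVec_eq_zero_iff] at h
  rw [eq_zero_of_evalMap_mapH_of_apply_one hv h, Matrix.mulVec_zero]

theorem eq_zero_of_evalMap_mapH {v : Fin 3 → ℂ} (h : evalMap mapH v = 0) : v = 0 := by
  by_contra hv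
  have hdet := eval_det_jacobian_eq_zero isHomogeneous_mapH hv h
  obtain ⟨c, hc, hJ⟩ := jacobianDet_mapH
  rw [← jacobianDet_eq, hJ, map_mul, eval_C, map_pow] at hdet
  obtain ⟨i, hi⟩ := eval_lineProduct_eq_zero_iff.mp
    (eq_zero_of_pow_eq_zero ((mul_eq_zero.mp hdet).resolve_left hc))
  exact hv (eq_zero_of_evalMap_mapH_of_reflForm hi h)

/-! ### Lifts of holomorphic maps -/

section Parallel

theorem evalMap_smul {R m n : Type*} [CommRing R] {P : m → MvPolynomial n R} {k : ℕ}
    (hP : ∀ i, (P i).IsHomogeneous k) (c : R) (v : n → R) :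
    evalMap P (c • v) = c ^ k • evalMap P v :=
  funext fun i => eval_smul_of_isHomogeneous (hP i) c v

theorem exists_eq_mul_of_span_range_eq_top {R ι : Type*} [CommRing R] [Finite ι] {a b : ι → R}
    (hb : Ideal.span (Set.range b) = ⊤) (h : ∀ i j, a i * b j = a j * b i) :
    ∃ e, ∀ j, a j = e * b j := by
  cases nonempty_fintype ι
  rw [Ideal.eq_top_iff_one, Ideal.mem_span_range_iff_exists_fun] at hb
  obtain ⟨u, hu⟩ := hb
  refine ⟨∑ i, u i * a i, fun j => ?_⟩
  calc a j = ∑ i, a j * (u i * b i) := by rw [← Finset.mul_sum, hu, mul_one]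
    _ = (∑ i, u i * a i) * b j := by
      rw [Finset.sum_mul]
      exact Finset.sum_congr rfl fun i _ => by linear_combination (-u i) * h i j

variable {K : Type*} [Field K] [IsAlgClosed K]

theorem span_range_eq_top_of_eval_ne_zero {ι : Type*} {b : ι → Polynomial K}
    (hb : ∀ t, ∃ i, (b i).eval t ≠ 0) : Ideal.span (Set.range b) = ⊤ := by
  obtain ⟨p, hp⟩ := (IsPrincipalIdealRing.principal (Ideal.span (Set.range b))).principal
  rw [Ideal.submodule_span_eq] at hp
  rw [hp, Ideal.span_singleton_eq_top, Polynomial.isUnit_iff_degree_eq_zero]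
  by_contra hdeg
  obtain ⟨t, ht⟩ := IsAlgClosed.exists_root p hdeg
  obtain ⟨i, hi⟩ := hb t
  have hdvd : p ∣ b i := by
    rw [← Ideal.mem_span_singleton, ← hp]
    exact Ideal.subset_span ⟨i, rfl⟩
  exact hi (ht.dvd hdvd)

theorem exists_eq_C_mul_of_parallel {ι : Type*} [Finite ι] {a b : ι → Polynomial K}
    (ha : ∀ t, ∃ i, (a i).eval t ≠ 0) (hb : ∀ t, ∃ i, (b i).eval t ≠ 0)
    (h : ∀ t, ∃ c, ∀ i, (a i).eval t = c * (b i).eval t) :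
    ∃ c, ∀ i, a i = Polynomial.C c * b i := by
  have hparallel (i j : ι) : a i * b j = a j * b i := by
    refine Polynomial.funext fun t => ?_
    obtain ⟨c, hc⟩ := h t
    rw [Polynomial.eval_mul, Polynomial.eval_mul, hc, hc]
    ring
  obtain ⟨e, he⟩ := exists_eq_mul_of_span_range_eq_top
    (span_range_eq_top_of_eval_ne_zero hb) hparallel
  have hdeg : e.degree = 0 := by
    by_contra hdeg
    obtain ⟨t, ht⟩ := IsAlgClosed.exists_root e hdeg
    obtain ⟨i, hi⟩ := ha t
    exact hi (by rw [he, Polynomial.eval_mul, ht.eq_zero, zero_mul])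
  rw [Polynomial.eq_C_of_degree_eq_zero hdeg] at he
  exact ⟨_, he⟩

variable {m n : Type*} [Finite m] {A B : m → MvPolynomial n K}

theorem exists_evalMap_line_eq_smul (hA : ∀ v, v ≠ 0 → evalMap A v ≠ 0)
    (hB : ∀ v, v ≠ 0 → evalMap B v ≠ 0)
    (h : ∀ v, v ≠ 0 → ∃ c : K, evalMap A v = c • evalMap B v) {e f : n → K}
    (hef : ∀ t : K, e + t • f ≠ 0) :
    ∃ c : K, ∀ t : K, evalMap A (e + t • f) = c • evalMap B (e + t • f) := by
  have hrestrict (P : m → MvPolynomial n K) (t : K) :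
      (fun i => (restrictLine e f (P i)).eval t) = evalMap P (e + t • f) :=
    funext fun i => eval_restrictLine e f (P i) t
  obtain ⟨c, hc⟩ := exists_eq_C_mul_of_parallel (a := fun i => restrictLine e f (A i))
    (b := fun i => restrictLine e f (B i))
    (fun t => Function.ne_iff.mp (by rw [hrestrict]; exact hA _ (hef t)))
    (fun t => Function.ne_iff.mp (by rw [hrestrict]; exact hB _ (hef t)))
    (fun t => by
      obtain ⟨c, hc⟩ := h _ (hef t)
      rw [← hrestrict, ← hrestrict] at hc
      exact ⟨c, congrFun hc⟩)
  refine ⟨c, fun t => ?_⟩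
  rw [← hrestrict, ← hrestrict]
  funext i
  simp only [hc, Polynomial.eval_mul, Polynomial.eval_C, Pi.smul_apply, smul_eq_mul]

theorem exists_evalMap_eq_smul [Nonempty n] {k : ℕ} (hAk : ∀ i, (A i).IsHomogeneous k)
    (hBk : ∀ i, (B i).IsHomogeneous k) (hA : ∀ v, v ≠ 0 → evalMap A v ≠ 0)
    (hB : ∀ v, v ≠ 0 → evalMap B v ≠ 0)
    (h : ∀ v, v ≠ 0 → ∃ c : K, evalMap A v = c • evalMap B v) :
    ∃ c : K, ∀ v, evalMap A v = c • evalMap B v := by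
  obtain ⟨e, he⟩ := exists_ne (0 : n → K)
  obtain ⟨c, hc⟩ := h e he
  refine ⟨c, fun w => ?_⟩
  by_cases hw : ∃ s : K, w = s • e
  · obtain ⟨s, rfl⟩ := hw
    rw [evalMap_smul hAk, evalMap_smul hBk, hc, smul_comm]
  have hline (t : K) : e + t • (w - e) ≠ 0 := fun ht => by
    have ht0 : t ≠ 0 := fun h0 => he (by simpa only [h0, zero_smul, add_zero] using ht)
    refine hw ⟨1 - t⁻¹, ?_⟩
    rw [← sub_eq_zero, ← smul_eq_zero_iff_right ht0, ← ht]
    match_scalars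
    · field_simp
    · field_simp
      ring
  obtain ⟨d, hd⟩ := exists_evalMap_line_eq_smul hA hB h hline
  have hd0 := hd 0
  have hd1 := hd 1
  rw [zero_smul, add_zero] at hd0
  rw [one_smul, add_sub_cancel] at hd1
  rw [hd1, smul_left_injective K (hB e he) (hc.symm.trans hd0)]

end Parallel

section Lift

variable {m n : ℕ} {P Q : Fin 3 → Poly3} {f g : CP2 → CP2}

theorem exists_isLift (hP : ∀ i, (P i).IsHomogeneous n)
    (h0 : ∀ v, evalMap P v = 0 → v = 0) : ∃ f, IsLift n P f := by
  refine ⟨Projectivization.lift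
    (fun v => Projectivization.mk ℂ (evalMap P v.1) fun h => v.2 (h0 _ h)) ?_, hP, ?_⟩
  · intro a b t hab
    rw [Projectivization.mk_eq_mk_iff']
    exact ⟨t ^ n, by rw [hab, evalMap_smul hP]⟩
  · intro v hv
    exact ⟨fun h => hv (h0 _ h), rfl⟩

theorem IsLift.evalMap_ne_zero (h : IsLift n P f) {v : Fin 3 → ℂ} (hv : v ≠ 0) :
    evalMap P v ≠ 0 := (h.2 v hv).1

theorem IsLift.apply_mk (h : IsLift n P f) {v : Fin 3 → ℂ} (hv : v ≠ 0) :
    f (Projectivization.mk ℂ v hv) = Projectivization.mk ℂ (evalMap P v) (h.evalMap_ne_zero hv) :=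
  (h.2 v hv).2

theorem IsLift.eq_of_evalMap_eq_smul (hf : IsLift m P f) (hg : IsLift n Q g) (c : ℂ)
    (h : ∀ v, evalMap P v = c • evalMap Q v) : f = g := by
  funext p
  induction p using Projectivization.ind with
  | h v hv =>
    rw [hf.apply_mk, hg.apply_mk, Projectivization.mk_eq_mk_iff']
    exact ⟨c, (h v).symm⟩

theorem IsLift.isEquivariant (h : IsLift n P f) (hG : linearGroup ≤ commutant P) :
    IsEquivariant f := by
  rintro _ ⟨g, hg, rfl⟩ p
  induction p using Projectivization.ind with
  | h v hv =>
    rw [h.apply_mk, Projectivization.PGL.mk_smul_mk, Projectivization.PGL.mk_smul_mk, h.apply_mk]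
    congr 1
    exact mem_commutant.mp (hG hg) v

end Lift

section Character

theorem isHomogeneous_linearSubst {R m n : Type*} [CommRing R] [Fintype n] (A : Matrix m n R)
    {p : MvPolynomial m R} {k : ℕ} (hp : p.IsHomogeneous k) :
    (linearSubst A p).IsHomogeneous k := by
  rw [← one_mul k]
  exact hp.aeval A.toMvPolynomial A.toMvPolynomial_isHomogeneous

theorem isHomogeneous_map_C_mulVec {R m n o : Type*} [CommRing R] [Fintype m] (A : Matrix o m R)
    {P : m → MvPolynomial n R} {k : ℕ} (hP : ∀ i, (P i).IsHomogeneous k) (i : o) :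
    ((A.map (C (σ := n)) *ᵥ P) i).IsHomogeneous k :=
  IsHomogeneous.sum _ _ _ fun j _ => (hP j).C_mul (A i j)

theorem IsLift.exists_evalMap_mulVec {n : ℕ} {P : Fin 3 → Poly3} {f : CP2 → CP2}
    (h : IsLift n P f) (hf : IsEquivariant f) {g : GL (Fin 3) ℂ} (hg : g ∈ linearGroup) :
    ∃ c : ℂ, ∀ v, evalMap P (g.1 *ᵥ v) = c • g.1 *ᵥ evalMap P v := by
  have hA (v : Fin 3 → ℂ) :
      evalMap (fun i => linearSubst g.1 (P i)) v = evalMap P (g.1 *ᵥ v) :=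
    funext fun i => by rw [evalMap, eval_linearSubst, evalMap]
  have hB (v : Fin 3 → ℂ) : evalMap (g.1.map (C (σ := Fin 3)) *ᵥ P) v = g.1 *ᵥ evalMap P v :=
    funext fun i => by rw [evalMap, eval_mulVec_map_C]
  have hparallel := exists_evalMap_eq_smul (fun i => isHomogeneous_linearSubst g.1 (h.1 i))
    (isHomogeneous_map_C_mulVec g.1 h.1)
  simp only [hA, hB] at hparallel
  have hne {v : Fin 3 → ℂ} (hv : v ≠ 0) : g.1 *ᵥ v ≠ 0 := (mulVec_eq_zero_iff g).not.mpr hv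
  refine hparallel (fun v hv => h.evalMap_ne_zero (hne hv))
    (fun v hv => hne (h.evalMap_ne_zero hv)) fun v hv => ?_
  have hfv := hf _ ⟨g, hg, rfl⟩ (Projectivization.mk ℂ v hv)
  rw [h.apply_mk, Projectivization.PGL.mk_smul_mk, Projectivization.PGL.mk_smul_mk, h.apply_mk,
    Projectivization.mk_eq_mk_iff'] at hfv
  obtain ⟨c, hc⟩ := hfv
  exact ⟨c, hc.symm⟩

theorem exists_monoidHom_evalMap_mulVec {K n : Type*} [Field K] [Fintype n] [DecidableEq n]
    {G : Subgroup (GL n K)} {P : n → MvPolynomial n K} {v₀ : n → K} (hv₀ : evalMap P v₀ ≠ 0)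
    (h : ∀ g ∈ G, ∃ c : K, ∀ v, evalMap P (g.1 *ᵥ v) = c • g.1 *ᵥ evalMap P v) :
    ∃ χ : G →* K, ∀ (g : G) v, evalMap P (g.1.1 *ᵥ v) = χ g • g.1.1 *ᵥ evalMap P v := by
  choose χ hχ using fun g : G => h g.1 g.2
  have hinj (g : G) : Function.Injective fun c : K => c • g.1.1 *ᵥ evalMap P v₀ :=
    smul_left_injective K ((mulVec_eq_zero_iff g.1).not.mpr hv₀)
  refine ⟨⟨⟨χ, hinj 1 ?_⟩, fun a b => hinj (a * b) ?_⟩, hχ⟩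
  · simpa using (hχ 1 v₀).symm
  · have hab := hχ (a * b) v₀
    simp only [Subgroup.coe_mul, Units.val_mul, ← Matrix.mulVec_mulVec] at hab ⊢
    rw [← hab, hχ a, hχ b, Matrix.mulVec_smul, smul_smul]

/-- The reflections are conjugate, and one of them is the product of two others. -/
theorem monoidHom_linearGroup_eq_one {A : Type*} [CommGroup A] (χ : linearGroup →* A) :
    χ = 1 := by
  let r : Fin 21 → linearGroup := fun i => ⟨refl i, refl_mem_linearGroup i⟩
  have hconj (i : Fin 21) : χ (r i) = χ (r 0) := by
    obtain ⟨k, hk, -, -, hki, -⟩ := exists_mem_linearGroup_mul_refl_eq i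
    have hχ : χ (⟨k, hk⟩ * r 0) = χ (r i * ⟨k, hk⟩) := congrArg χ (Subtype.ext hki)
    rw [map_mul, map_mul, mul_comm] at hχ
    exact (mul_right_cancel hχ).symm
  have hprod : r 6 * r 7 = r 8 := Subtype.ext (refl_mul_refl_eq (by decide +kernel))
  have hr0 : χ (r 0) = 1 := by
    have hχ := congrArg χ hprod
    rw [map_mul, hconj 6, hconj 7, hconj 8] at hχ
    exact mul_eq_left.mp hχ
  have hle : linearGroup ≤ χ.ker.map linearGroup.subtype := by
    refine linearGroup_le_closure_refl.trans ((Subgroup.closure_le _).mpr ?_)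
    rintro _ ⟨i, rfl⟩
    exact ⟨r i, (hconj i).trans hr0, rfl⟩
  ext g
  obtain ⟨k, hk, hkg⟩ := hle g.2
  rw [← Subtype.ext hkg]
  exact hk

theorem IsLift.linearGroup_le_commutant {n : ℕ} {P : Fin 3 → Poly3} {f : CP2 → CP2}
    (h : IsLift n P f) (hf : IsEquivariant f) : linearGroup ≤ commutant P := by
  obtain ⟨χ, hχ⟩ := exists_monoidHom_evalMap_mulVec (h.evalMap_ne_zero one_ne_zero)
    fun g hg => h.exists_evalMap_mulVec hf hg
  have hχ1 (g : linearGroup) : χ g = 1 :=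
    congrArg Units.val (DFunLike.congr_fun (monoidHom_linearGroup_eq_one χ.toHomUnits) g)
  exact fun g hg v => by rw [hχ ⟨g, hg⟩, hχ1, one_smul]

end Character

/-! ### The critical set -/

theorem mk_mem_sUnion_reflectionLines {v : Fin 3 → ℂ} (hv : v ≠ 0) :
    Projectivization.mk ℂ v hv ∈ ⋃₀ reflectionLines ↔ eval v lineProduct = 0 := by
  rw [reflectionLines_eq, eval_lineProduct_eq_zero_iff]
  simp only [Set.sUnion_range, Set.mem_iUnion, mk_mem_projLine hv]

theorem mk_mem_zeroSet_iff {p : Poly3} {n : ℕ} (hp : p.IsHomogeneous n) {v : Fin 3 → ℂ}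
    (hv : v ≠ 0) :
    Projectivization.mk ℂ v hv ∈ {x : CP2 | eval x.rep p = 0} ↔ eval v p = 0 := by
  obtain ⟨c, hc⟩ := Projectivization.exists_smul_eq_mk_rep ℂ v hv
  rw [Set.mem_ofPred_eq, ← hc, Units.smul_def, eval_smul_of_isHomogeneous hp,
    mul_eq_zero_iff_left (pow_ne_zero n c.ne_zero)]

theorem zeroSet_eq_iff {p : Poly3} {n : ℕ} (hp : p.IsHomogeneous n) :
    {x : CP2 | eval x.rep p = 0} = ⋃₀ reflectionLines ↔
      ∀ v : Fin 3 → ℂ, v ≠ 0 → (eval v p = 0 ↔ eval v lineProduct = 0) := by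
  refine Set.ext_iff.trans ⟨fun h v hv => ?_, fun h x => ?_⟩
  · rw [← mk_mem_zeroSet_iff hp hv, h, mk_mem_sUnion_reflectionLines]
  · induction x using Projectivization.ind with
    | h v hv => rw [mk_mem_zeroSet_iff hp, h v hv, mk_mem_sUnion_reflectionLines]

theorem linearForm_dvd_lineProduct (i : Fin 21) : linearForm (reflForm i) ∣ lineProduct :=
  Finset.dvd_prod_of_mem (fun i => linearForm (reflForm i)) (Finset.mem_univ i)

theorem emultiplicity_linearForm_lineProduct (i : Fin 21) :
    emultiplicity (linearForm (reflForm i)) lineProduct = 1 := by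
  have hprime := prime_linearForm i
  rw [lineProduct, Finset.emultiplicity_prod hprime, Finset.sum_eq_single i
    (fun j _ hj => emultiplicity_eq_zero.mpr (not_linearForm_dvd hj.symm)) (by simp)]
  exact (FiniteMultiplicity.of_prime_left hprime hprime.ne_zero).emultiplicity_self

theorem linearForm_smul (s : ℂ) (a : Fin 3 → ℂ) : linearForm (s • a) = C s * linearForm a :=
  MvPolynomial.funext fun v => by
    rw [map_mul, eval_C, eval_linearForm, eval_linearForm, smul_dotProduct, smul_eq_mul]

theorem emultiplicity_linearForm_C_mul_lineProduct_sq {c : ℂ} (hc : c ≠ 0) {a : Fin 3 → ℂ}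
    (ha : IsReflectionForm a) : emultiplicity (linearForm a) (C c * lineProduct ^ 2) = 2 := by
  obtain ⟨i, s, hs, rfl⟩ := exists_eq_smul_reflForm ha
  rw [linearForm_smul,
    emultiplicity_eq_of_associated_left (associated_unit_mul_right _ _ (isUnit_C hs)),
    emultiplicity_eq_of_associated_right (associated_unit_mul_left _ _ (isUnit_C hc)),
    emultiplicity_pow (prime_linearForm i), emultiplicity_linearForm_lineProduct, mul_one]
  rfl

theorem isDoublyCritical_of_isLift_mapH {f : CP2 → CP2} (h : IsLift 15 mapH f) :
    IsDoublyCriticalAtReflectionLines f := by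
  obtain ⟨c, hc, hJ⟩ := jacobianDet_mapH
  refine ⟨15, mapH, h, ?_, fun a ha => ?_⟩
  · rw [zeroSet_eq_iff (isHomogeneous_jacobianDet isHomogeneous_mapH)]
    intro v _
    rw [hJ, map_mul, eval_C, map_pow, mul_eq_zero_iff_left hc, sq_eq_zero_iff]
  · rw [hJ]
    exact emultiplicity_linearForm_C_mul_lineProduct_sq hc ha

theorem exists_dvd_pow_of_eval_eq_zero {K n : Type*} [Field K] [IsAlgClosed K] [Finite n]
    {p r : MvPolynomial n K} (h : ∀ v, eval v r = 0 → eval v p = 0) : ∃ k, r ∣ p ^ k := by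
  have hp : p ∈ (Ideal.span {r}).radical := by
    rw [← vanishingIdeal_zeroLocus_eq_radical (K := K), mem_vanishingIdeal_iff]
    exact fun v hv => h v (hv r (Ideal.mem_span_singleton_self r))
  obtain ⟨k, hk⟩ := hp
  exact ⟨k, Ideal.mem_span_singleton.mp hk⟩

theorem isUnit_of_not_linearForm_dvd {q : Poly3}
    (hzero : ∀ v, eval v q = 0 → eval v lineProduct = 0)
    (hq : ∀ i, ¬ linearForm (reflForm i) ∣ q) : IsUnit q := by
  by_contra hunit
  have hq0 : q ≠ 0 := by
    rintro rfl
    exact hq 0 (dvd_zero _)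
  obtain ⟨r, hr, hrq⟩ := WfDvdMonoid.exists_irreducible_factor hunit hq0
  obtain ⟨k, hk⟩ := exists_dvd_pow_of_eval_eq_zero (p := lineProduct) (r := r) fun v hv =>
    hzero v (by rw [← zero_dvd_iff, ← hv]; exact map_dvd (eval v) hrq)
  obtain ⟨i, -, hi⟩ := hr.prime.exists_mem_finset_dvd (hr.prime.dvd_of_dvd_pow hk)
  exact hq i ((hr.associated_of_dvd (prime_linearForm i).irreducible hi).symm.dvd.trans hrq)

theorem eq_C_mul_lineProduct_sq {p : Poly3} (hzero : ∀ v, eval v p = 0 → eval v lineProduct = 0)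
    (hmult : ∀ i, emultiplicity (linearForm (reflForm i)) p = 2) :
    ∃ c : ℂ, c ≠ 0 ∧ p = C c * lineProduct ^ 2 := by
  have hdvd (i : Fin 21) : linearForm (reflForm i) ^ 2 ∣ p ∧ ¬ linearForm (reflForm i) ^ 3 ∣ p :=
    (emultiplicity_eq_coe (n := 2)).mp (hmult i)
  obtain ⟨q, rfl⟩ := lineProduct_pow_dvd fun i => (hdvd i).1
  have hunit : IsUnit q := by
    refine isUnit_of_not_linearForm_dvd (fun v hv => hzero v ?_) fun i hi => (hdvd i).2 ?_
    · rw [map_mul, hv, mul_zero]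
    · rw [pow_succ]
      exact mul_dvd_mul (pow_dvd_pow_of_dvd (linearForm_dvd_lineProduct i) 2) hi
  obtain ⟨c, hc, rfl⟩ := isUnit_iff_eq_C_of_isReduced.mp hunit
  exact ⟨c, hc.ne_zero, mul_comm _ _⟩

theorem exists_isLift_fifteen {f : CP2 → CP2} (hf : IsDoublyCriticalAtReflectionLines f) :
    ∃ P, IsLift 15 P f ∧ lineProduct ^ 2 ∣ jacobianDet P := by
  obtain ⟨n, P, h, hzero, hmult⟩ := hf
  have hJ := isHomogeneous_jacobianDet h.1
  have hzero' (v : Fin 3 → ℂ) (hv : eval v (jacobianDet P) = 0) : eval v lineProduct = 0 := by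
    rcases eq_or_ne v 0 with rfl | hv0
    · exact eval_lineProduct_eq_zero_iff.mpr ⟨0, dotProduct_zero _⟩
    · exact ((zeroSet_eq_iff hJ).mp hzero v hv0).mp hv
  obtain ⟨c, hc, hP⟩ := eq_C_mul_lineProduct_sq hzero' fun i =>
    hmult _ (isReflectionForm_reflForm i)
  have hne : C c * lineProduct ^ 2 ≠ 0 :=
    mul_ne_zero (isUnit_C hc).ne_zero (pow_ne_zero 2 lineProduct_ne_zero)
  rw [hP] at hJ
  have hdeg := hJ.inj_right ((isHomogeneous_lineProduct.pow 2).C_mul c) hne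
  obtain rfl : n = 15 := by lia
  exact ⟨P, h, hP ▸ dvd_mul_left _ _⟩

/-! ### Uniqueness -/

theorem X_pow_dvd_of_lineProduct_pow_dvd {p : Poly3} {n : ℕ} (h : lineProduct ^ n ∣ p) :
    X 1 ^ n ∣ p := by
  have hX : X 1 ∣ lineProduct := by
    refine dvd_trans ?_ (linearForm_dvd_lineProduct 0)
    rw [reflForm_zero, linearForm_single]
    exact dvd_mul_left _ _
  exact (pow_dvd_pow_of_dvd hX n).trans h

theorem exists_eval_lineProduct_ne_zero : ∃ v : Fin 3 → ℂ, eval v lineProduct ≠ 0 := by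
  by_contra! h
  exact lineProduct_ne_zero (MvPolynomial.funext fun v => by rw [h v, map_zero])

theorem exists_det_add_smul_eq_zero {K n : Type*} [Field K] [IsAlgClosed K] [Fintype n]
    [DecidableEq n] [Nonempty n] (A : Matrix n n K) {B : Matrix n n K} (hB : B.det ≠ 0) :
    ∃ t : K, (A + t • B).det = 0 := by
  obtain ⟨s, hs⟩ := IsAlgClosed.exists_root (B⁻¹ * A).charpoly (by
    rw [Matrix.charpoly_degree_eq_dim]
    exact_mod_cast Fintype.card_ne_zero)
  rw [Polynomial.IsRoot, Matrix.eval_charpoly] at hs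
  have hfactor : A + (-s) • B = -(B * (Matrix.scalar n s - B⁻¹ * A)) := by
    rw [mul_sub, ← mul_assoc, Matrix.mul_nonsing_inv _ (isUnit_iff_ne_zero.mpr hB), one_mul,
      Matrix.scalar_apply, ← Matrix.smul_one_eq_diagonal, Matrix.mul_smul, mul_one]
    module
  exact ⟨-s, by rw [hfactor, Matrix.det_neg, Matrix.det_mul, hs, mul_zero, mul_zero]⟩

theorem exists_eval_jacobianDet_add_C_mul_mapH_eq_zero (P : Fin 3 → Poly3) :
    ∃ v t, eval v lineProduct ≠ 0 ∧ eval v (jacobianDet (P + fun i => C t * mapH i)) = 0 := by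
  obtain ⟨v, hv⟩ := exists_eval_lineProduct_ne_zero
  obtain ⟨c, hc, hH⟩ := jacobianDet_mapH
  have heval (Q : Fin 3 → Poly3) :
      eval v (jacobianDet Q) = ((jacobian Q).map (eval v)).det := (eval v).map_det (jacobian Q)
  obtain ⟨t, ht⟩ := exists_det_add_smul_eq_zero ((jacobian P).map (eval v))
    (B := (jacobian mapH).map (eval v)) (by
      rw [← heval, hH, map_mul, eval_C, map_pow]
      exact mul_ne_zero hc (pow_ne_zero 2 hv))
  refine ⟨v, t, hv, ?_⟩
  rw [heval, ← ht]
  congr 1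
  ext i j
  simp [jacobian]

theorem exists_evalMap_eq_smul_evalMap_mapH {P : Fin 3 → Poly3}
    (hP : ∀ i, (P i).IsHomogeneous 15) (hG : linearGroup ≤ commutant P)
    (hJ : lineProduct ^ 2 ∣ jacobianDet P) : ∃ c : ℂ, ∀ v, evalMap P v = c • evalMap mapH v := by
  obtain ⟨v, t, hv, hvt⟩ := exists_eval_jacobianDet_add_C_mul_mapH_eq_zero P
  set R : Fin 3 → Poly3 := P + fun i => C t * mapH i with hR
  have hRhom (i : Fin 3) : (R i).IsHomogeneous 15 := (hP i).add ((isHomogeneous_mapH i).C_mul t)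
  have hRG : linearGroup ≤ commutant R := fun g hg => commutant_inf_le_add
    ⟨hG hg, mul_mem_commutant (bind₁_C_right _ t) (linearGroup_le_commutant_mapH hg)⟩
  have hR1 : X 1 ^ 3 ∣ R 1 :=
    dvd_add (X_pow_succ_dvd_apply_one hG (by decide) hP (by decide)
      (X_pow_dvd_of_lineProduct_pow_dvd hJ)) (X_pow_three_dvd_mapH_one.mul_left _)
  have hRJ : jacobianDet R = 0 := by
    obtain ⟨d, hd⟩ := eq_C_mul_of_dvd_of_isHomogeneous (isHomogeneous_jacobianDet hRhom)
      (isHomogeneous_lineProduct.pow 2)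
      (lineProduct_pow_dvd_jacobianDet hRG (X_pow_dvd_jacobianDet hR1))
    rw [hd, map_mul, eval_C, map_pow, mul_eq_zero_iff_right (pow_ne_zero 2 hv)] at hvt
    rw [hd, hvt, C_0, zero_mul]
  have hR0 := eq_zero_of_jacobianDet_eq_zero hRG (by decide) hRhom (by decide) hRJ
  refine ⟨-t, fun w => funext fun i => ?_⟩
  have hw : eval w (R i) = 0 := by rw [hR0, Pi.zero_apply, map_zero]
  rw [hR, Pi.add_apply, map_add, map_mul, eval_C] at hw
  rw [neg_smul]
  exact eq_neg_of_add_eq_zero_left hw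

end KleinHeptic

theorem mainTheorem1 :
    KleinHeptic.reflectionLines.ncard = 21 ∧
    ∃ h : KleinHeptic.CP2 → KleinHeptic.CP2,
      KleinHeptic.IsLift 15 KleinHeptic.mapH h ∧
      ∀ f : KleinHeptic.CP2 → KleinHeptic.CP2,
        (KleinHeptic.IsHolomorphicMap f ∧ KleinHeptic.IsEquivariant f ∧
          KleinHeptic.IsDoublyCriticalAtReflectionLines f) ↔ f = h := by
  obtain ⟨h, hh⟩ := KleinHeptic.exists_isLift KleinHeptic.isHomogeneous_mapH
    fun _ => KleinHeptic.eq_zero_of_evalMap_mapH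
  refine ⟨KleinHeptic.reflectionLines_ncard, h, hh, fun f => ⟨?_, ?_⟩⟩
  · rintro ⟨-, hf, hcrit⟩
    obtain ⟨P, hP, hJ⟩ := KleinHeptic.exists_isLift_fifteen hcrit
    obtain ⟨c, hc⟩ := KleinHeptic.exists_evalMap_eq_smul_evalMap_mapH hP.1
      (hP.linearGroup_le_commutant hf) hJ
    exact hP.eq_of_evalMap_eq_smul hh c hc
  · rintro rfl
    exact ⟨⟨15, _, hh⟩, hh.isEquivariant KleinHeptic.linearGroup_le_commutant_mapH,
      KleinHeptic.isDoublyCritical_of_isLift_mapH hh⟩
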